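/- **Setting.** Let $h:\mathbb R^d\to(-\infty,+\infty]$ be convex with $C:=\operatorname{int}\operatorname{dom}h\neq\emptyset$, twice continuously differentiable and strictly convex on $C$, with $\|\nabla h(x_n)\|\to\infty$ whenever $x_n\in C$ converges to a boundary point of $\operatorname{dom}h$ (a Legendre kernel). Assume $h$ is $\zeta$-HRUC regular: $\zeta:[0,\infty)\to[0,\infty)$ is continuous and non-decreasing with $\zeta(0)=0$, $\nabla^2h(y)$ is invertible for $y\in C$, and $\|\nabla^2h(x)[\nabla^2h(y)]^{-1}-I\|\le\zeta(r)$ for all $r\ge0$ and $x,y\in C$ with $\|\nabla h(x)-\nabla h(y)\|\le r$. Let $h^*(z)=\sup_{x\in\operatorname{dom}h}(\langle z,x\rangle-h(x))$. Let $m\ge1$, let $f_1,\dots,f_m$ be $C^2$ on $C$, let $L>0$ be such that $Lh\pm f_i$ are convex on $C$ for each $i$, and let $f=\frac1m\sum_if_i$ satisfy $f\ge f_{\rm low}$ on $C$. Let $W\in\mathbb R^{m\times m}$ be symmetric and doubly stochastic with $\rho:=\|W-\frac1m\mathbf 1\mathbf 1^\top\|<1$ (spectral norm). Put $\lambda=1+\zeta\big(\frac{\sqrt{20m}}{1-\rho}\,\delta\big)$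 and let $\eta,\delta>0$ satisfy $$\eta\le\frac{(1-\rho)^2}{25L\lambda^2},\qquad \zeta(2\delta)\le\frac{1-\rho}{2}.$$ Let $\mathcal T_\eta^\delta(v)=\eta v$ if $\eta\|v\|\le\delta$ and $\mathcal T_\eta^\delta(v)=\delta v/\|v\|$ otherwise. Given $x^0\in C$ and $y_1^0,\dots,y_m^0\in\mathbb R^d$, the method DMGT starts at $x_i^0=x^0$, $z_i^0=\nabla h(x^0)$ and iterates, for $t\ge0$ and $i=1,\dots,m$, $$z_i^{t+1}=\sum_jW_{ij}\big(z_j^t-\mathcal T_\eta^\delta(y_j^t)\big),\qquad x_i^{t+1}=\nabla h^*(z_i^{t+1}),\qquad y_i^{t+1}=\sum_jW_{ij}y_j^t+\nabla f_i(x_i^{t+1})-\nabla f_i(x_i^t).$$ Assume that either $y_i^0=0$ for all $i$, or $\frac1m\sum_iy_i^0=\nabla f(x^0)$. Let $\bar z^t=\frac1m\sum_iz_i^t$ and $\mathcal T=\{t\ge0:\mathcal T_\eta^\delta(y_i^t)\ne\eta y_i^t\text{ for some }i\}$. **Proposition.** Assume in addition that for every $c\in\mathbb R$ the set $\{\nabla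 h(x):x\in C,\ f(x)\le c\}$ is bounded. Then: 1. $\mathcal T$ is finite, that is, the clipping operator is active only finitely many times. 2. There are $0<\mu^*<L^*<\infty$ such that $\mu^*I\preceq\nabla^2h^*(z)\preceq L^*I$ for all $t\ge0$ and all $z$ on the segment $[\bar z^t,\bar z^{t+1}]$. 3. If moreover $y_1^0=\dots=y_m^0$, then for every $\mu^*>0$ satisfying the lower bound in 2, $$|\mathcal T|\le\frac{12\,m\,\eta\,(f(x^0)-f_{\rm low})}{\mu^*\delta^2}.$$ -/

import Mathlib

open Set Filter Topology

noncomputable section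

namespace DMGT

/-- The space `ℝ^d` with its Euclidean norm. -/
abbrev E (d : ℕ) := EuclideanSpace ℝ (Fin d)

/-- The Hessian `∇²h(x)`, as a linear operator on `ℝ^d`. -/
def hess {d : ℕ} (h : E d → ℝ) (x : E d) : E d →L[ℝ] E d :=
  fderiv ℝ (gradient h) x

/-- A twice continuously differentiable Legendre kernel. An extended-valued convex kernel
`h : ℝ^d → (-∞, +∞]` is given by its domain `D = dom h` and its real values on `D`; the values
of the function `h` outside `D` are irrelevant. The constraint set is the closure of `D`. -/
structure IsLegendreKernel {d : ℕ} (D : Set (E d)) (h : E d → ℝ) : Prop where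
  convex : ConvexOn ℝ D h
  interior_nonempty : (interior D).Nonempty
  contDiff : ContDiffOn ℝ 2 h (interior D)
  /-- essential smoothness: the gradient blows up at the boundary of the domain -/
  blowup : ∀ x ∈ frontier D, Tendsto (fun u => ‖gradient h u‖) (𝓝[interior D] x) atTop
  /-- essential strict convexity: strict convexity on `dom ∇h = int dom h` -/
  strictConvex : StrictConvexOn ℝ (interior D) h

/-- Hessian relative uniform continuity with distortion modulus `ζ : [0, ∞) → [0, ∞)`;
the values of `ζ` at negative numbers are irrelevant. The invertibility of the Hessian is what
the expression `[∇²h(y)]⁻¹` presupposes. -/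
structure IsHRUC {d : ℕ} (D : Set (E d)) (h : E d → ℝ) (ζ : ℝ → ℝ) : Prop where
  zero : ζ 0 = 0
  mono : MonotoneOn ζ (Ici 0)
  cont : ContinuousOn ζ (Ici 0)
  invertible : ∀ y ∈ interior D, (hess h y).IsInvertible
  bound : ∀ δ : ℝ, 0 ≤ δ → ∀ x ∈ interior D, ∀ y ∈ interior D,
    ‖gradient h x - gradient h y‖ ≤ δ →
    ‖(hess h x).comp (hess h y).inverse - ContinuousLinearMap.id ℝ (E d)‖ ≤ ζ δ

/-- `f` is smooth relative to the kernel with modulus `L`: both `L h + f` and `L h - f`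
are convex. -/
def IsRelSmooth {d : ℕ} (D : Set (E d)) (h : E d → ℝ) (L : ℝ) (f : E d → ℝ) : Prop :=
  ConvexOn ℝ (interior D) (fun x => L * h x + f x) ∧
  ConvexOn ℝ (interior D) (fun x => L * h x - f x)

/-- The convex conjugate `h*(z) = sup_{x ∈ dom h} (⟨z, x⟩ - h(x))`. For a Legendre kernel
satisfying Hessian relative uniform continuity this supremum is finite at every `z`. -/
def conj {d : ℕ} (D : Set (E d)) (h : E d → ℝ) (z : E d) : ℝ :=
  sSup ((fun x => inner ℝ z x - h x) '' D)

/-- `ρ = ‖W - (1/m) 1 1ᵀ‖` in the spectral norm. -/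
def mixingRate {m : ℕ} (W : Matrix (Fin m) (Fin m) ℝ) : ℝ :=
  ‖Matrix.toEuclideanCLM (n := Fin m) (𝕜 := ℝ) (W - Matrix.of fun _ _ => 1 / (m : ℝ))‖

/-- The global objective `f = (1/m) ∑ i, f i`. -/
def globalObj {m d : ℕ} (f : Fin m → E d → ℝ) (x : E d) : ℝ :=
  1 / (m : ℝ) * ∑ i, f i x

/-- The average of `m` vectors. -/
def avg {m d : ℕ} (v : Fin m → E d) : E d :=
  (1 / (m : ℝ)) • ∑ i, v i

/-- The clipping operator. -/
def clip {d : ℕ} (η δ : ℝ) (v : E d) : E d :=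
  if η * ‖v‖ ≤ δ then η • v else (δ / ‖v‖) • v

/-- `λ = 1 + ζ (√(20 m) / (1 - ρ) * δ)`. -/
def lam (m : ℕ) (ζ : ℝ → ℝ) (ρ δ : ℝ) : ℝ :=
  1 + ζ (Real.sqrt (20 * m) / (1 - ρ) * δ)

/-- The local variables of the `m` agents at one iteration. -/
structure State (m d : ℕ) where
  /-- primal variables -/
  x : Fin m → E d
  /-- gradient trackers -/
  y : Fin m → E d
  /-- dual variables -/
  z : Fin m → E d

section

variable {m d : ℕ} (D : Set (E d)) (h : E d → ℝ) (f : Fin m → E d → ℝ)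
  (W : Matrix (Fin m) (Fin m) ℝ) (η δ : ℝ)

/-- One iteration of dual mixing gradient tracking. -/
def step (s : State m d) : State m d :=
  let z' : Fin m → E d := fun i => ∑ j, W i j • (s.z j - clip η δ (s.y j))
  let x' : Fin m → E d := fun i => gradient (conj D h) (z' i)
  { x := x'
    y := fun i => (∑ j, W i j • s.y j) + gradient (f i) (x' i) - gradient (f i) (s.x i)
    z := z' }

/-- The iterates, started at the common primal point `x0` with trackers `y0`. -/
def iter (x0 : E d) (y0 : Fin m → E d) : ℕ → State m d
  | 0 => { x := fun _ => x0, y := y0, z := fun _ => gradient h x0 }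
  | t + 1 => step D h f W η δ (iter x0 y0 t)

/-- The iterations in which the clipping operator is active for some agent. -/
def clippedSteps (x0 : E d) (y0 : Fin m → E d) : Set ℕ :=
  {t | ∃ i, clip η δ ((iter D h f W η δ x0 y0 t).y i) ≠ η • (iter D h f W η δ x0 y0 t).y i}

/-- The average dual variable at iteration `t`. -/
def zbar (x0 : E d) (y0 : Fin m → E d) (t : ℕ) : E d :=
  avg (iter D h f W η δ x0 y0 t).z

end

/-- `μ I ≼ ∇²h*(z)` at all points `z` of all segments `[zb t, zb (t + 1)]`. -/
def HessLower {d : ℕ} (D : Set (E d)) (h : E d → ℝ) (zb : ℕ → E d) (μ : ℝ) : Prop :=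
  ∀ t, ∀ z ∈ segment ℝ (zb t) (zb (t + 1)), ∀ v : E d,
    μ * ‖v‖ ^ 2 ≤ inner ℝ v (hess (conj D h) z v)

/-- `∇²h*(z) ≼ M I` at all points `z` of all segments `[zb t, zb (t + 1)]`. -/
def HessUpper {d : ℕ} (D : Set (E d)) (h : E d → ℝ) (zb : ℕ → E d) (M : ℝ) : Prop :=
  ∀ t, ∀ z ∈ segment ℝ (zb t) (zb (t + 1)), ∀ v : E d,
    inner ℝ v (hess (conj D h) z v) ≤ M * ‖v‖ ^ 2

end DMGT

end

/-! Everything is done in dual coordinates. The mirror map `∇h` is a bijection from `interior D`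
onto the whole space (`gradient_image_eq_univ`), its inverse is `∇h*`, and A(z) = ∇²h*(z) = [∇²h]⁻¹
is positive definite. The HRUC bound on the operator norm of ∇²h A becomes a Loewner comparison A(z)
≼ (1 + ζ(r)) A(w) for ‖z - w‖ ≤ r (`inner_hess_conj_le`). Errors are therefore measured in the norm
of P_t, the average of A over the segment from z̄^t to z̄^{t+1}, for which P_t(z̄^{t+1} - z̄^t) is
exactly the corresponding primal displacement.

Clipping bounds every dual step by δ, so the agents stay within a fixed distance of their mean. On
that region A and P_t agree up to the factor λ, and relative smoothness makes the dual gradients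
λL-Lipschitz in the P_t norm (`norm_gradient_mirrorInv_sub_le`). Passing from P_t to P_{t+1} costs a
factor 1 + ζ(2δ), which the contraction of W absorbs. As a result m f at the mean plus weighted
consensus errors of y and z decreases by at least S_t/(12η), where S_t = ∑ ⟨c_i, P_t c_i⟩ and c_i
are the clipped steps (`lyapunov_step`).

No bound on A is needed for this descent. It keeps the means in one sublevel set of f, hence
bounded, and compactness gives the bounds μ*, L*. A clipped iteration has S_t ≥ μ*δ², while ∑ S_t is
finite because f is bounded below, so such iterations can be counted. If the initial trackers
coincide, both consensus errors start at zero, which gives the explicit constant. -/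

namespace DMGT

/-! ### Gradients and Hessians of convex and relatively smooth functions. -/

section ConvexCalculus

variable {d : ℕ}

lemma hasDerivAt_comp_line {h : E d → ℝ} {x : E d} (hd : DifferentiableAt ℝ h x) (v : E d) :
    HasDerivAt (fun s : ℝ => h (x + s • v)) (inner ℝ (gradient h x) v) 0 := by
  have h1 : HasDerivAt (fun s : ℝ => x + s • v) v 0 := by
    simpa using ((hasDerivAt_id (0 : ℝ)).smul_const v).const_add x
  have h2 : HasFDerivAt h (InnerProductSpace.toDual ℝ (E d) (gradient h x)) (x + (0 : ℝ) • v) := by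
    simpa using hd.hasGradientAt.hasFDerivAt
  exact (h2.comp_hasDerivAt (0 : ℝ) h1).congr_deriv (by simp)

/-- Convexity bounds the difference quotients towards `y`; let the step tend to zero. Only `x` needs
differentiability, so `y` may lie on the boundary of the domain, as the supremum over `D` in `conj`
requires. -/
lemma gradient_inequality {D : Set (E d)} {h : E d → ℝ} (hc : ConvexOn ℝ D h) {x y : E d}
    (hx : x ∈ D) (hy : y ∈ D) (hd : DifferentiableAt ℝ h x) :
    h x + inner ℝ (gradient h x) (y - x) ≤ h y := by
  have h1 := (hasDerivAt_comp_line hd (y - x)).tendsto_slope_zero_right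
  have h2 : ∀ᶠ s : ℝ in 𝓝[>] 0,
      s⁻¹ • (h (x + (0 + s) • (y - x)) - h (x + (0 : ℝ) • (y - x))) ≤ h y - h x := by
    filter_upwards [Ioo_mem_nhdsGT (zero_lt_one' ℝ)] with s hs
    have h3 := hc.2 hx hy (sub_nonneg.2 hs.2.le) hs.1.le (by ring)
    have h4 : x + (0 + s) • (y - x) = (1 - s) • x + s • y := by module
    rw [h4, zero_smul, add_zero, smul_eq_mul, inv_mul_le_iff₀ hs.1]
    simp only [smul_eq_mul] at h3
    linarith
  linarith [le_of_tendsto h1 h2]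

lemma differentiableAt_of_contDiffOn {C : Set (E d)} {h : E d → ℝ} (hC : IsOpen C)
    (hh : ContDiffOn ℝ 2 h C) {x : E d} (hx : x ∈ C) : DifferentiableAt ℝ h x :=
  (hh.contDiffAt (hC.mem_nhds hx)).differentiableAt two_ne_zero

lemma contDiffAt_gradient {C : Set (E d)} {h : E d → ℝ} (hC : IsOpen C)
    (hh : ContDiffOn ℝ 2 h C) {x : E d} (hx : x ∈ C) : ContDiffAt ℝ 1 (gradient h) x :=
  (InnerProductSpace.toDual ℝ (E d)).symm.contDiff.contDiffAt.comp x
    ((hh.contDiffAt (hC.mem_nhds hx)).fderiv_right (m := 1) (by norm_num))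

lemma hasFDerivAt_gradient {C : Set (E d)} {h : E d → ℝ} (hC : IsOpen C)
    (hh : ContDiffOn ℝ 2 h C) {x : E d} (hx : x ∈ C) : HasFDerivAt (gradient h) (hess h x) x :=
  ((contDiffAt_gradient hC hh hx).differentiableAt one_ne_zero).hasFDerivAt

lemma continuousOn_hess {C : Set (E d)} {h : E d → ℝ} (hC : IsOpen C)
    (hh : ContDiffOn ℝ 2 h C) : ContinuousOn (hess h) C := fun _ hx =>
  ((contDiffAt_gradient hC hh hx).fderiv_right (m := 0) (by norm_num)).continuousAt.continuousWithinAt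

lemma inner_hess_symm {C : Set (E d)} {h : E d → ℝ} (hC : IsOpen C)
    (hh : ContDiffOn ℝ 2 h C) {x : E d} (hx : x ∈ C) (u v : E d) :
    inner ℝ u (hess h x v) = inner ℝ (hess h x u) v := by
  have h1 := ((hh.contDiffAt (hC.mem_nhds hx)).isSymmSndFDerivAt (by simp)) u v
  have h2 : HasFDerivAt (gradient h)
      ((InnerProductSpace.toDual ℝ (E d)).symm.toContinuousLinearEquiv.toContinuousLinearMap.comp
        (fderiv ℝ (fderiv ℝ h) x)) x :=
    (InnerProductSpace.toDual ℝ (E d)).symm.toContinuousLinearEquiv.hasFDerivAt.comp x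
      (((hh.contDiffAt (hC.mem_nhds hx)).fderiv_right (m := 1)
        (by norm_num)).differentiableAt one_ne_zero).hasFDerivAt
  have h3 : ∀ u v : E d, inner ℝ (hess h x u) v = fderiv ℝ (fderiv ℝ h) x u v := by
    intro u v
    rw [hess, h2.fderiv]
    simp
  rw [real_inner_comm, h3, h3, h1]

/-- The Hessian of a convex `C²` function is positive semidefinite. -/
lemma inner_hess_nonneg {C : Set (E d)} {h : E d → ℝ} (hC : IsOpen C)
    (hh : ContDiffOn ℝ 2 h C) (hc : ConvexOn ℝ C h) {x : E d} (hx : x ∈ C) (v : E d) :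
    0 ≤ inner ℝ v (hess h x v) := by
  have h1 : HasDerivAt (fun s : ℝ => x + s • v) v 0 := by
    simpa using ((hasDerivAt_id (0 : ℝ)).smul_const v).const_add x
  have h2 : HasDerivAt (fun s : ℝ => gradient h (x + s • v)) (hess h x v) 0 := by
    have h3 : HasFDerivAt (gradient h) (hess h x) (x + (0 : ℝ) • v) := by
      simpa using hasFDerivAt_gradient hC hh hx
    exact h3.comp_hasDerivAt (0 : ℝ) h1
  have h4 := ((hasDerivAt_const (0 : ℝ) v).inner ℝ h2).tendsto_slope_zero_right
  have h5 : ∀ᶠ s : ℝ in 𝓝 0, x + s • v ∈ C :=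
    h1.continuousAt.eventually_mem (hC.mem_nhds (by simpa using hx))
  -- Adding the gradient inequalities at `x` and at `x + s • v` shows that the gradient is monotone;
  -- the Hessian form is the limit of these quotients.
  have h6 : ∀ᶠ s : ℝ in 𝓝[>] 0, 0 ≤ s⁻¹ • (inner ℝ v (gradient h (x + (0 + s) • v))
      - inner ℝ v (gradient h (x + (0 : ℝ) • v))) := by
    filter_upwards [self_mem_nhdsWithin, nhdsWithin_le_nhds h5] with s (hs : 0 < s) hsC
    have h7 := gradient_inequality hc hx hsC (differentiableAt_of_contDiffOn hC hh hx)
    have h8 := gradient_inequality hc hsC hx (differentiableAt_of_contDiffOn hC hh hsC)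
    rw [show x + s • v - x = s • v by abel, inner_smul_right] at h7
    rw [show x - (x + s • v) = -(s • v) by abel, inner_neg_right, inner_smul_right] at h8
    rw [zero_add, zero_smul, add_zero, smul_eq_mul, real_inner_comm, real_inner_comm _ v]
    have h9 : 0 ≤ s * (inner ℝ (gradient h (x + s • v)) v - inner ℝ (gradient h x) v) := by
      linarith
    exact mul_nonneg (inv_nonneg.2 hs.le) (by
      by_contra hneg
      linarith [mul_neg_of_pos_of_neg hs (not_le.1 hneg)])
  simpa using ge_of_tendsto h4 h6

/-- The gradient of a strictly convex function is injective. -/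
lemma injOn_gradient {C : Set (E d)} {h : E d → ℝ} (hC : IsOpen C)
    (hh : ContDiffOn ℝ 2 h C) (hc : StrictConvexOn ℝ C h) : InjOn (gradient h) C := by
  intro x hx y hy hxy
  by_contra hne
  have h1 := hc.2 hx hy hne (by norm_num : (0 : ℝ) < 1 / 2) (by norm_num : (0 : ℝ) < 1 / 2)
    (by norm_num)
  have hm : (1 / 2 : ℝ) • x + (1 / 2 : ℝ) • y ∈ C :=
    hc.1 hx hy (by norm_num) (by norm_num) (by norm_num)
  -- The tangents at `x` and `y` have the same slope, so at the midpoint their linear terms cancel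
  -- and the midpoint value is at least the mean, against strict convexity.
  have h2 := gradient_inequality hc.convexOn hx hm (differentiableAt_of_contDiffOn hC hh hx)
  have h3 := gradient_inequality hc.convexOn hy hm (differentiableAt_of_contDiffOn hC hh hy)
  rw [show (1 / 2 : ℝ) • x + (1 / 2 : ℝ) • y - x = (1 / 2 : ℝ) • (y - x) by module,
    inner_smul_right] at h2
  rw [show (1 / 2 : ℝ) • x + (1 / 2 : ℝ) • y - y = -((1 / 2 : ℝ) • (y - x)) by module,
    inner_neg_right, inner_smul_right, ← hxy] at h3
  simp only [smul_eq_mul] at h1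
  linarith

lemma gradient_const_mul_add {h f : E d → ℝ} {x : E d} (L : ℝ) (hh : DifferentiableAt ℝ h x)
    (hf : DifferentiableAt ℝ f x) :
    gradient (fun x => L * h x + f x) x = L • gradient h x + gradient f x := by
  have h1 : HasFDerivAt (fun x => L * h x + f x) (L • fderiv ℝ h x + fderiv ℝ f x) x :=
    (hh.hasFDerivAt.const_mul L).add hf.hasFDerivAt
  simp [gradient, h1.fderiv]

lemma gradient_const_mul_sub {h f : E d → ℝ} {x : E d} (L : ℝ) (hh : DifferentiableAt ℝ h x)
    (hf : DifferentiableAt ℝ f x) :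
    gradient (fun x => L * h x - f x) x = L • gradient h x - gradient f x := by
  have h1 : HasFDerivAt (fun x => L * h x - f x) (L • fderiv ℝ h x - fderiv ℝ f x) x :=
    (hh.hasFDerivAt.const_mul L).sub hf.hasFDerivAt
  simp [gradient, h1.fderiv]

lemma gradient_globalObj {m : ℕ} {f : Fin m → E d → ℝ} {x : E d}
    (hf : ∀ i, DifferentiableAt ℝ (f i) x) :
    gradient (globalObj f) x = avg fun i => gradient (f i) x := by
  have h1 : HasFDerivAt (globalObj f) ((1 / (m : ℝ)) • ∑ i, fderiv ℝ (f i) x) x := by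
    have h2 : HasFDerivAt (fun x => ∑ i, f i x) (∑ i, fderiv ℝ (f i) x) x :=
      HasFDerivAt.fun_sum fun i _ => (hf i).hasFDerivAt
    exact h2.const_mul _
  simp [gradient, avg, h1.fderiv]

/-- Relative smoothness bounds the quadratic form of the Hessian of `f` by that of `h`. -/
lemma IsRelSmooth.abs_inner_hess_le {D : Set (E d)} {h f : E d → ℝ} {L : ℝ}
    (hs : IsRelSmooth D h L f) (hh : ContDiffOn ℝ 2 h (interior D))
    (hf : ContDiffOn ℝ 2 f (interior D)) {x : E d} (hx : x ∈ interior D) (v : E d) :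
    |inner ℝ v (hess f x v)| ≤ L * inner ℝ v (hess h x v) := by
  have hO : IsOpen (interior D) := isOpen_interior
  have hg := hasFDerivAt_gradient hO hh hx
  have hg' := hasFDerivAt_gradient hO hf hx
  have h1 := inner_hess_nonneg hO ((contDiffOn_const.mul hh).add hf) hs.1 hx v
  have h2 := inner_hess_nonneg hO ((contDiffOn_const.mul hh).sub hf) hs.2 hx v
  have h3 : hess (fun x => L * h x + f x) x = L • hess h x + hess f x := by
    refine (HasFDerivAt.congr_of_eventuallyEq ((hg.const_smul L).add hg') ?_).fderiv
    filter_upwards [hO.mem_nhds hx] with y hy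
    exact gradient_const_mul_add L (differentiableAt_of_contDiffOn hO hh hy)
      (differentiableAt_of_contDiffOn hO hf hy)
  have h4 : hess (fun x => L * h x - f x) x = L • hess h x - hess f x := by
    refine (HasFDerivAt.congr_of_eventuallyEq ((hg.const_smul L).sub hg') ?_).fderiv
    filter_upwards [hO.mem_nhds hx] with y hy
    exact gradient_const_mul_sub L (differentiableAt_of_contDiffOn hO hh hy)
      (differentiableAt_of_contDiffOn hO hf hy)
  rw [h3] at h1
  rw [h4] at h2
  simp only [add_apply, sub_apply, smul_apply, inner_add_right, inner_sub_right,
    inner_smul_right] at h1 h2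
  rw [abs_le]
  constructor <;> linarith

/-- The descent inequality of relative smoothness, with the Bregman distance bounded by the
symmetrized one. -/
lemma IsRelSmooth.descent {D : Set (E d)} {h f : E d → ℝ} {L : ℝ} (hL : 0 ≤ L)
    (hs : IsRelSmooth D h L f) (hc : ConvexOn ℝ (interior D) h)
    (hh : ContDiffOn ℝ 2 h (interior D))
    (hf : ContDiffOn ℝ 2 f (interior D)) {x y : E d} (hx : x ∈ interior D)
    (hy : y ∈ interior D) :
    f y - f x ≤ inner ℝ (gradient f x) (y - x)
      + L * inner ℝ (gradient h y - gradient h x) (y - x) := by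
  have hO : IsOpen (interior D) := isOpen_interior
  have hd := fun {x} (hx : x ∈ interior D) => differentiableAt_of_contDiffOn hO hh hx
  have hd' := differentiableAt_of_contDiffOn hO hf hx
  have h1 := gradient_inequality hs.2 hx hy (((hd hx).const_mul L).sub hd')
  rw [gradient_const_mul_sub L (hd hx) hd', inner_sub_left, inner_smul_left] at h1
  -- The Bregman distance and the symmetrized one differ by the reverse Bregman distance, which is
  -- nonnegative.
  have h2 := gradient_inequality hc hy hx (hd hy)
  rw [← neg_sub y x, inner_neg_right] at h2
  have h3 := mul_le_mul_of_nonneg_left h2 hL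
  rw [inner_sub_left]
  simp only [conj_trivial] at h1
  nlinarith

end ConvexCalculus

/-! ### The mirror map is a bijection whose inverse is the gradient of the conjugate. -/

section MirrorMap

variable {d : ℕ} {D : Set (E d)} {h : E d → ℝ} {ζ : ℝ → ℝ}

lemma IsHRUC.modulus_nonneg (hH : IsHRUC D h ζ) {r : ℝ} (hr : 0 ≤ r) : 0 ≤ ζ r := by
  have := hH.mono (mem_Ici.2 le_rfl) (mem_Ici.2 hr) hr
  rwa [hH.zero] at this

/-- The inverse of the mirror map `∇h : int D → ℝ^d`. -/
noncomputable def mirrorInv (D : Set (E d)) (h : E d → ℝ) : E d → E d :=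
  Function.invFunOn (gradient h) (interior D)

lemma mirrorInv_gradient (hLeg : IsLegendreKernel D h) {x : E d} (hx : x ∈ interior D) :
    mirrorInv D h (gradient h x) = x :=
  (injOn_gradient isOpen_interior hLeg.contDiff hLeg.strictConvex).leftInvOn_invFunOn hx

lemma hasStrictFDerivAt_gradient (hLeg : IsLegendreKernel D h) {x : E d} (hx : x ∈ interior D) :
    HasStrictFDerivAt (gradient h) (hess h x) x :=
  (contDiffAt_gradient isOpen_interior hLeg.contDiff hx).hasStrictFDerivAt'
    (hasFDerivAt_gradient isOpen_interior hLeg.contDiff hx) one_ne_zero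

/-- Inverse function theorem for a local left inverse. It is stated at image points only, because
surjectivity is derived from it. -/
lemma hasFDerivAt_mirrorInv_gradient (hLeg : IsLegendreKernel D h) (hH : IsHRUC D h ζ)
    {x : E d} (hx : x ∈ interior D) :
    HasFDerivAt (mirrorInv D h) (hess h x).inverse (gradient h x) := by
  obtain ⟨e, he⟩ := hH.invertible x hx
  have h1 := hasStrictFDerivAt_gradient hLeg hx
  rw [← he] at h1 ⊢
  rw [ContinuousLinearMap.inverse_equiv]
  refine (h1.to_local_left_inverse ?_).hasFDerivAt
  filter_upwards [isOpen_interior.mem_nhds hx] with y hy using mirrorInv_gradient hLeg hy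

lemma isOpen_gradient_image (hLeg : IsLegendreKernel D h) (hH : IsHRUC D h ζ) :
    IsOpen (gradient h '' interior D) := by
  rw [isOpen_iff_mem_nhds]
  rintro _ ⟨x, hx, rfl⟩
  obtain ⟨e, he⟩ := hH.invertible x hx
  have h1 := hasStrictFDerivAt_gradient hLeg hx
  rw [← he] at h1
  rw [← h1.map_nhds_eq_of_equiv]
  exact image_mem_map (isOpen_interior.mem_nhds hx)

lemma hess_comp_inverse_norm_le (hH : IsHRUC D h ζ) {x y : E d} (hx : x ∈ interior D)
    (hy : y ∈ interior D) {r : ℝ} (hr : ‖gradient h x - gradient h y‖ ≤ r) :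
    ‖(hess h x).comp (hess h y).inverse‖ ≤ 1 + ζ r := by
  have h1 := hH.bound r ((norm_nonneg _).trans hr) x hx y hy hr
  have h2 : (hess h x).comp (hess h y).inverse = ContinuousLinearMap.id ℝ (E d) +
      ((hess h x).comp (hess h y).inverse - ContinuousLinearMap.id ℝ (E d)) := by abel
  rw [h2]
  exact (norm_add_le _ _).trans (add_le_add ContinuousLinearMap.norm_id_le h1)

/-- Factor H(y)⁻¹ = H(x)⁻¹ (H(x) H(y)⁻¹). The inverse Hessian stays bounded over dual balls, so the
inverse mirror map is Lipschitz there. -/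
lemma hess_inverse_norm_le (hH : IsHRUC D h ζ) {x y : E d} (hx : x ∈ interior D)
    (hy : y ∈ interior D) {r : ℝ} (hr : ‖gradient h x - gradient h y‖ ≤ r) :
    ‖(hess h y).inverse‖ ≤ ‖(hess h x).inverse‖ * (1 + ζ r) := by
  have h1 : (hess h y).inverse = (hess h x).inverse.comp ((hess h x).comp (hess h y).inverse) := by
    obtain ⟨e, he⟩ := hH.invertible x hx
    rw [← he, ContinuousLinearMap.inverse_equiv]
    ext1 v
    simp
  rw [h1]
  exact (ContinuousLinearMap.opNorm_comp_le _ _).trans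
    (mul_le_mul_of_nonneg_left (hess_comp_inverse_norm_le hH hx hy hr) (norm_nonneg _))

/-- The mirror map of a Legendre kernel with relatively uniformly continuous Hessian is onto. -/
theorem gradient_image_eq_univ (hLeg : IsLegendreKernel D h) (hH : IsHRUC D h ζ) :
    gradient h '' interior D = univ := by
  by_contra hne
  set U := gradient h '' interior D with hU
  obtain ⟨x, hx⟩ := hLeg.interior_nonempty
  set p := gradient h x with hp
  -- A nearest missing point `q`: the open ball around `p` reaching up to `q` lies in the image.
  obtain ⟨q, hq, hpq⟩ := (isOpen_gradient_image hLeg hH).isClosed_compl.exists_infDist_eq_dist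
    (nonempty_compl.2 hne) p
  set R := dist p q with hR
  have hRpos : 0 < R := dist_pos.2 fun hpq' => hq (hpq' ▸ mem_image_of_mem _ hx)
  have hball : Metric.ball p R ⊆ U := by
    intro z hz
    by_contra hzU
    have := Metric.infDist_le_dist_of_mem (x := p) (show z ∈ Uᶜ from hzU)
    rw [Metric.mem_ball, dist_comm] at hz
    linarith
  set K := ‖(hess h x).inverse‖ * (1 + ζ R) with hK
  have hK0 : 0 ≤ K := mul_nonneg (norm_nonneg _) (by linarith [hH.modulus_nonneg hRpos.le])
  have hLip : LipschitzOnWith ⟨K, hK0⟩ (mirrorInv D h) (Metric.ball p R) := by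
    refine (convex_ball p R).lipschitzOnWith_of_nnnorm_hasFDerivWithin_le
      (f' := fun z => fderiv ℝ (mirrorInv D h) z) ?_ ?_
    · intro z hz
      obtain ⟨y, hy, rfl⟩ := hball hz
      exact (hasFDerivAt_mirrorInv_gradient hLeg hH hy).differentiableAt.hasFDerivAt.hasFDerivWithinAt
    · intro z hz
      obtain ⟨y, hy, rfl⟩ := hball hz
      rw [(hasFDerivAt_mirrorInv_gradient hLeg hH hy).fderiv]
      refine hess_inverse_norm_le hH hx hy ?_
      rw [Metric.mem_ball, dist_comm, dist_eq_norm] at hz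
      exact hz.le
  -- A Lipschitz extension supplies the limit `g q` of the preimages as the dual point tends to `q`
  -- inside the ball.
  obtain ⟨g, hg, hgG⟩ := hLip.extend_finite_dimension
  have hNe : (𝓝[Metric.ball p R] q).NeBot := by
    rw [← mem_closure_iff_nhdsWithin_neBot, closure_ball p hRpos.ne', Metric.mem_closedBall,
      dist_comm]
  have hG : Tendsto (mirrorInv D h) (𝓝[Metric.ball p R] q) (𝓝[interior D] (g q)) := by
    refine tendsto_nhdsWithin_iff.2 ⟨?_, ?_⟩
    · refine (hg.continuous.continuousAt.tendsto.mono_left nhdsWithin_le_nhds).congr' ?_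
      filter_upwards [self_mem_nhdsWithin] with z hz using (hgG hz).symm
    · filter_upwards [self_mem_nhdsWithin] with z hz
      obtain ⟨y, hy, rfl⟩ := hball hz
      rwa [mirrorInv_gradient hLeg hy]
  have hid : (fun z => gradient h (mirrorInv D h z)) =ᶠ[𝓝[Metric.ball p R] q] id := by
    filter_upwards [self_mem_nhdsWithin] with z hz
    obtain ⟨y, hy, rfl⟩ := hball hz
    rw [mirrorInv_gradient hLeg hy, id]
  have hlim : Tendsto id (𝓝[Metric.ball p R] q) (𝓝 q) := tendsto_id.mono_left nhdsWithin_le_nhds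
  -- If the limit is interior, continuity of the gradient puts `q` in the image. If it lies on the
  -- frontier, the gradient norms blow up although they tend to `‖q‖`.
  by_cases hgq : g q ∈ interior D
  · have h1 : Tendsto (fun z => gradient h (mirrorInv D h z)) (𝓝[Metric.ball p R] q)
        (𝓝 (gradient h (g q))) :=
      (contDiffAt_gradient isOpen_interior hLeg.contDiff hgq).continuousAt.tendsto.comp
        (hG.mono_right nhdsWithin_le_nhds)
    exact hq ⟨g q, hgq, tendsto_nhds_unique (h1.congr' hid) hlim⟩
  · have hcl : g q ∈ closure D := by
      refine closure_mono interior_subset (mem_closure_iff_nhdsWithin_neBot.2 ?_)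
      exact hG.neBot
    have h1 := ((hLeg.blowup (g q) ⟨hcl, hgq⟩).comp hG).congr'
      (hid.mono fun z hz => congrArg norm hz)
    exact not_tendsto_nhds_of_tendsto_atTop h1 _ hlim.norm

lemma mirrorInv_mem (hLeg : IsLegendreKernel D h) (hH : IsHRUC D h ζ) (z : E d) :
    mirrorInv D h z ∈ interior D :=
  Function.invFunOn_mem ((gradient_image_eq_univ hLeg hH).ge (mem_univ z))

lemma gradient_mirrorInv (hLeg : IsLegendreKernel D h) (hH : IsHRUC D h ζ) (z : E d) :
    gradient h (mirrorInv D h z) = z :=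
  Function.invFunOn_eq ((gradient_image_eq_univ hLeg hH).ge (mem_univ z))

lemma hasFDerivAt_mirrorInv (hLeg : IsLegendreKernel D h) (hH : IsHRUC D h ζ) (z : E d) :
    HasFDerivAt (mirrorInv D h) (hess h (mirrorInv D h z)).inverse z := by
  simpa [gradient_mirrorInv hLeg hH] using
    hasFDerivAt_mirrorInv_gradient hLeg hH (mirrorInv_mem hLeg hH z)

lemma continuous_mirrorInv (hLeg : IsLegendreKernel D h) (hH : IsHRUC D h ζ) :
    Continuous (mirrorInv D h) :=
  continuous_iff_continuousAt.2 fun z => (hasFDerivAt_mirrorInv hLeg hH z).continuousAt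

/-- The gradient inequality at the point whose gradient is `z` says that this point attains the
supremum. -/
lemma conj_eq (hLeg : IsLegendreKernel D h) (hH : IsHRUC D h ζ) (z : E d) :
    conj D h z = inner ℝ z (mirrorInv D h z) - h (mirrorInv D h z) := by
  refine IsGreatest.csSup_eq ⟨⟨_, interior_subset (mirrorInv_mem hLeg hH z), rfl⟩, ?_⟩
  rintro _ ⟨x, hx, rfl⟩
  have h1 := gradient_inequality hLeg.convex (interior_subset (mirrorInv_mem hLeg hH z)) hx
    (differentiableAt_of_contDiffOn isOpen_interior hLeg.contDiff (mirrorInv_mem hLeg hH z))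
  rw [gradient_mirrorInv hLeg hH, inner_sub_right] at h1
  simp only
  linarith

lemma conj_subgradient (hLeg : IsLegendreKernel D h) (hH : IsHRUC D h ζ) (z w : E d) :
    conj D h z + inner ℝ (mirrorInv D h z) (w - z) ≤ conj D h w := by
  have h1 := gradient_inequality hLeg.convex (interior_subset (mirrorInv_mem hLeg hH w))
    (interior_subset (mirrorInv_mem hLeg hH z))
    (differentiableAt_of_contDiffOn isOpen_interior hLeg.contDiff (mirrorInv_mem hLeg hH w))
  rw [gradient_mirrorInv hLeg hH, inner_sub_right] at h1
  rw [conj_eq hLeg hH, conj_eq hLeg hH, inner_sub_right, real_inner_comm w, real_inner_comm z]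
  linarith

/-- The two subgradient inequalities squeeze the remainder between 0 and ⟨G w - G z, w - z⟩ with G =
`mirrorInv D h`; continuity of G makes it o(‖w - z‖). -/
theorem gradient_conj (hLeg : IsLegendreKernel D h) (hH : IsHRUC D h ζ) :
    gradient (conj D h) = mirrorInv D h := by
  funext z
  refine HasGradientAt.gradient (hasGradientAt_iff_isLittleO.2 ?_)
  refine Asymptotics.isLittleO_iff.2 fun c hc => ?_
  have h1 : ∀ᶠ w in 𝓝 z, ‖mirrorInv D h w - mirrorInv D h z‖ ≤ c := by
    have := (continuous_mirrorInv hLeg hH).continuousAt (x := z)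
    filter_upwards [this (Metric.closedBall_mem_nhds _ hc)] with w hw
    rwa [← dist_eq_norm]
  filter_upwards [h1] with w hw
  have h2 := conj_subgradient hLeg hH z w
  have h3 := conj_subgradient hLeg hH w z
  have h4 := real_inner_le_norm (mirrorInv D h w - mirrorInv D h z) (w - z)
  rw [inner_sub_left] at h4
  rw [← neg_sub w z, inner_neg_right] at h3
  rw [Real.norm_eq_abs, abs_of_nonneg (by linarith)]
  nlinarith [norm_nonneg (w - z)]

lemma hess_conj (hLeg : IsLegendreKernel D h) (hH : IsHRUC D h ζ) (z : E d) :
    hess (conj D h) z = (hess h (mirrorInv D h z)).inverse := by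
  rw [hess, gradient_conj hLeg hH, (hasFDerivAt_mirrorInv hLeg hH z).fderiv]

lemma continuous_hess_conj (hLeg : IsLegendreKernel D h) (hH : IsHRUC D h ζ) :
    Continuous (hess (conj D h)) := by
  rw [funext (hess_conj hLeg hH)]
  refine continuous_iff_continuousAt.2 fun z => ?_
  have hm := mirrorInv_mem hLeg hH z
  have h1 : ContinuousAt ContinuousLinearMap.inverse (hess h (mirrorInv D h z)) :=
    ((hH.invertible _ hm).contDiffAt_map_inverse (n := 0)).continuousAt
  have h2 : ContinuousAt (hess h) (mirrorInv D h z) :=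
    (continuousOn_hess isOpen_interior hLeg.contDiff).continuousAt (isOpen_interior.mem_nhds hm)
  exact ContinuousAt.comp (f := fun z => hess h (mirrorInv D h z)) h1
    (ContinuousAt.comp (f := mirrorInv D h) h2 (continuous_mirrorInv hLeg hH).continuousAt)

lemma hess_hess_conj (hLeg : IsLegendreKernel D h) (hH : IsHRUC D h ζ) (z v : E d) :
    hess h (mirrorInv D h z) (hess (conj D h) z v) = v := by
  obtain ⟨e, he⟩ := hH.invertible _ (mirrorInv_mem hLeg hH z)
  rw [hess_conj hLeg hH, ← he, ContinuousLinearMap.inverse_equiv]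
  simp

lemma inner_hess_conj_symm (hLeg : IsLegendreKernel D h) (hH : IsHRUC D h ζ) (z u v : E d) :
    inner ℝ u (hess (conj D h) z v) = inner ℝ (hess (conj D h) z u) v := by
  have h1 := inner_hess_symm isOpen_interior hLeg.contDiff (mirrorInv_mem hLeg hH z)
    (hess (conj D h) z u) (hess (conj D h) z v)
  rw [hess_hess_conj hLeg hH, hess_hess_conj hLeg hH] at h1
  exact h1.symm

lemma inner_hess_conj_nonneg (hLeg : IsLegendreKernel D h) (hH : IsHRUC D h ζ) (z v : E d) :
    0 ≤ inner ℝ v (hess (conj D h) z v) := by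
  have h1 := inner_hess_nonneg isOpen_interior hLeg.contDiff hLeg.strictConvex.convexOn
    (mirrorInv_mem hLeg hH z) (hess (conj D h) z v)
  rwa [hess_hess_conj hLeg hH, real_inner_comm] at h1

/-- A vector on which a positive semidefinite form vanishes lies in its kernel. -/
lemma apply_eq_zero_of_inner_eq_zero {Q : E d →L[ℝ] E d}
    (hsymm : ∀ u v, inner ℝ u (Q v) = inner ℝ (Q u) v) (hpos : ∀ v, 0 ≤ inner ℝ v (Q v))
    {v : E d} (hv : inner ℝ v (Q v) = 0) : Q v = 0 := by
  -- A nonnegative quadratic in `s` without constant term has no linear term, by its discriminant.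
  have h1 : ∀ s : ℝ, 0 ≤ inner ℝ (Q v) (Q (Q v)) * (s * s) + (2 * ‖Q v‖ ^ 2) * s + 0 := by
    intro s
    have h2 := hpos (v + s • Q v)
    simp only [map_add, map_smul, inner_add_left, inner_add_right, inner_smul_left,
      inner_smul_right, conj_trivial, hv, real_inner_self_eq_norm_sq] at h2
    rw [hsymm v (Q v), real_inner_self_eq_norm_sq] at h2
    linarith
  have h3 := discrim_le_zero h1
  rw [discrim] at h3
  have h4 : ‖Q v‖ ^ 2 = 0 := by nlinarith [sq_nonneg (‖Q v‖ ^ 2)]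
  simpa using h4

/-- A zero of the semidefinite form lies in the kernel, which is trivial because the operator is
invertible. -/
lemma inner_hess_conj_pos (hLeg : IsLegendreKernel D h) (hH : IsHRUC D h ζ) (z : E d) {v : E d}
    (hv : v ≠ 0) : 0 < inner ℝ v (hess (conj D h) z v) := by
  refine lt_of_le_of_ne (inner_hess_conj_nonneg hLeg hH z v) fun h0 => hv ?_
  have h1 := apply_eq_zero_of_inner_eq_zero (inner_hess_conj_symm hLeg hH z)
    (inner_hess_conj_nonneg hLeg hH z) h0.symm
  rw [← hess_hess_conj hLeg hH z v, h1, map_zero]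

end MirrorMap

/-! ### Loewner comparison of Hessians, averaged Hessians and local norms. -/

section LocalNorms

variable {d : ℕ}

/-- A positive semidefinite operator has a square factor. -/
lemma exists_inner_factor {P : E d →L[ℝ] E d}
    (hsymm : ∀ u v, inner ℝ u (P v) = inner ℝ (P u) v) (hpos : ∀ v, 0 ≤ inner ℝ v (P v)) :
    ∃ B : E d →L[ℝ] E d, ∀ u v, inner ℝ u (P v) = inner ℝ (B u) (B v) := by
  open scoped MatrixOrder in
  set M := (Matrix.toEuclideanCLM (n := Fin d) (𝕜 := ℝ)).symm P with hM
  have hP : Matrix.toEuclideanCLM (n := Fin d) (𝕜 := ℝ) M = P := by simp [hM]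
  have hMpos : M.PosSemidef := by
    rw [← Matrix.isPositive_toEuclideanLin_iff]
    have h1 : Matrix.toEuclideanLin M = (P : E d →ₗ[ℝ] E d) := by
      rw [← hP]
      rfl
    rw [h1]
    refine ⟨fun u v => (hsymm u v).symm, fun v => ?_⟩
    simpa [real_inner_comm] using hpos v
  have h2 := CFC.sqrt_mul_sqrt_self M hMpos.nonneg
  have h3 : star (CFC.sqrt M) = CFC.sqrt M := (CFC.sqrt_nonneg M).isSelfAdjoint
  refine ⟨Matrix.toEuclideanCLM (n := Fin d) (𝕜 := ℝ) (CFC.sqrt M), fun u v => ?_⟩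
  rw [← ContinuousLinearMap.adjoint_inner_right, ← ContinuousLinearMap.star_eq_adjoint, ← map_star,
    h3, ← mul_apply_eq_comp, ← map_mul, h2, hP]

/-- If `P` is positive definite and `P N` is symmetric then the operator norm of `N` bounds the
form of `P N` by that of `P`. -/
lemma inner_comp_le_of_opNorm_le {P N : E d →L[ℝ] E d} {κ : ℝ}
    (hP : ∀ u v, inner ℝ u (P v) = inner ℝ (P u) v) (hpos : ∀ v, v ≠ 0 → 0 < inner ℝ v (P v))
    (hPN : ∀ u v, inner ℝ u (P (N v)) = inner ℝ (P (N u)) v) (hN : ‖N‖ ≤ κ) (v : E d) :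
    inner ℝ v (P (N v)) ≤ κ * inner ℝ v (P v) := by
  rcases eq_or_ne v 0 with rfl | hv
  · simp
  have hS : IsCompact (Metric.sphere (0 : E d) 1) := isCompact_sphere 0 1
  have hne : ∀ u ∈ Metric.sphere (0 : E d) 1, u ≠ 0 := by
    rintro u hu rfl
    simp at hu
  -- Maximize the Rayleigh quotient of P N against P over the sphere. At a maximizer with value r
  -- the semidefinite form r P - P N vanishes, so `N u = r • u`, and an eigenvalue is at most the
  -- operator norm.
  obtain ⟨u, hu, hmax⟩ := hS.exists_isMaxOn
    (⟨‖v‖⁻¹ • v, by simp [norm_smul, norm_ne_zero_iff.2 hv]⟩ : (Metric.sphere (0 : E d) 1).Nonempty)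
    (f := fun u => inner ℝ u (P (N u)) / inner ℝ u (P u))
    (ContinuousOn.div (by fun_prop) (by fun_prop) fun u hu => (hpos u (hne u hu)).ne')
  set r := inner ℝ u (P (N u)) / inner ℝ u (P u) with hr
  have hur : inner ℝ u (P (N u)) = r * inner ℝ u (P u) := by
    rw [hr, div_mul_cancel₀ _ (hpos u (hne u hu)).ne']
  have hle : ∀ w, inner ℝ w (P (N w)) ≤ r * inner ℝ w (P w) := by
    intro w
    rcases eq_or_ne w 0 with rfl | hw
    · simp
    have h1 := hmax (show ‖w‖⁻¹ • w ∈ Metric.sphere (0 : E d) 1 by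
      simp [norm_smul, norm_ne_zero_iff.2 hw])
    have hw0 := norm_ne_zero_iff.2 hw
    simp only [mem_ofPred_eq, map_smul, inner_smul_left, inner_smul_right, conj_trivial] at h1
    rwa [mul_div_mul_left _ _ (inv_ne_zero hw0), mul_div_mul_left _ _ (inv_ne_zero hw0),
      ← hr, div_le_iff₀ (hpos w hw)] at h1
  have hker : (r • P - P.comp N) u = 0 := by
    refine apply_eq_zero_of_inner_eq_zero (fun a b => ?_) (fun w => ?_) ?_
    · simp [inner_sub_left, inner_sub_right, inner_smul_left, inner_smul_right, hP a b, hPN a b]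
    · simpa [inner_sub_right, inner_smul_right] using hle w
    · simp [inner_sub_right, inner_smul_right, hur]
  have hker' : N u = r • u := by
    by_contra hcon
    have h1 : P (r • u - N u) = 0 := by simpa using hker
    have h2 := hpos _ (sub_ne_zero.2 (Ne.symm hcon))
    rw [h1, inner_zero_right] at h2
    exact lt_irrefl _ h2
  have hrκ : r ≤ κ := by
    have h1 := N.le_opNorm u
    have hu1 : ‖u‖ = 1 := by simpa using hu
    rw [hker', norm_smul, hu1, mul_one, mul_one, Real.norm_eq_abs] at h1
    exact (le_abs_self r).trans (h1.trans hN)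
  exact (hle v).trans (mul_le_mul_of_nonneg_right hrκ (hpos v hv).le)

variable {D : Set (E d)} {h : E d → ℝ} {ζ : ℝ → ℝ}

/-- Relative uniform continuity makes the Hessians of the conjugate comparable in the
Loewner order. -/
theorem inner_hess_conj_le (hLeg : IsLegendreKernel D h) (hH : IsHRUC D h ζ) {z w : E d} {r : ℝ}
    (hr : ‖z - w‖ ≤ r) (v : E d) :
    inner ℝ v (hess (conj D h) z v) ≤ (1 + ζ r) * inner ℝ v (hess (conj D h) w v) := by
  have hN := hess_comp_inverse_norm_le hH (mirrorInv_mem hLeg hH w) (mirrorInv_mem hLeg hH z)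
    (r := r) (by rwa [gradient_mirrorInv hLeg hH, gradient_mirrorInv hLeg hH, norm_sub_rev])
  have hAH : ∀ v, hess (conj D h) w (hess h (mirrorInv D h w) v) = v := by
    intro v
    obtain ⟨e, he⟩ := hH.invertible _ (mirrorInv_mem hLeg hH w)
    rw [hess_conj hLeg hH, ← he, ContinuousLinearMap.inverse_equiv]
    simp
  rw [← hess_conj hLeg hH z] at hN
  -- With P = A(w) and N = H(w) A(z) the product P N is A(z), which is symmetric although N need not
  -- be.
  have h1 := inner_comp_le_of_opNorm_le (P := hess (conj D h) w) (inner_hess_conj_symm hLeg hH w)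
    (fun v hv => inner_hess_conj_pos hLeg hH w hv)
    (N := (hess h (mirrorInv D h w)).comp (hess (conj D h) z))
    (fun u v => by simpa [hAH] using inner_hess_conj_symm hLeg hH z u v) hN v
  simpa [hAH] using h1

/-- The average of the Hessian of the conjugate over the segment from `z` to `w`. -/
noncomputable def avgHess (D : Set (E d)) (h : E d → ℝ) (z w : E d) : E d →L[ℝ] E d :=
  ∫ s in (0 : ℝ)..1, hess (conj D h) (z + s • (w - z))

lemma continuous_hess_conj_line (hLeg : IsLegendreKernel D h) (hH : IsHRUC D h ζ) (z w : E d) :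
    Continuous fun s : ℝ => hess (conj D h) (z + s • (w - z)) :=
  (continuous_hess_conj hLeg hH).comp (by fun_prop)

lemma inner_avgHess (hLeg : IsLegendreKernel D h) (hH : IsHRUC D h ζ) (z w u v : E d) :
    inner ℝ u (avgHess D h z w v) =
      ∫ s in (0 : ℝ)..1, inner ℝ u (hess (conj D h) (z + s • (w - z)) v) := by
  have h1 := ((innerSL ℝ u).comp
    (ContinuousLinearMap.apply ℝ (E d) v)).intervalIntegral_comp_comm
      ((continuous_hess_conj_line hLeg hH z w).intervalIntegrable (μ := MeasureTheory.volume) 0 1)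
  simpa [avgHess] using h1.symm

/-- Fundamental theorem of calculus along the segment. It turns primal displacements into dual ones
exactly, with no error term. -/
lemma avgHess_sub (hLeg : IsLegendreKernel D h) (hH : IsHRUC D h ζ) (z w : E d) :
    avgHess D h z w (w - z) = mirrorInv D h w - mirrorInv D h z := by
  have hcont := continuous_hess_conj_line hLeg hH z w
  have h1 := (ContinuousLinearMap.apply ℝ (E d) (w - z)).intervalIntegral_comp_comm
    (hcont.intervalIntegrable (μ := MeasureTheory.volume) 0 1)
  have h2 : ∀ s : ℝ, HasDerivAt (fun s : ℝ => mirrorInv D h (z + s • (w - z)))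
      (hess (conj D h) (z + s • (w - z)) (w - z)) s := by
    intro s
    have h3 : HasDerivAt (fun s : ℝ => z + s • (w - z)) (w - z) s := by
      simpa using ((hasDerivAt_id s).smul_const (w - z)).const_add z
    have h4 := hasFDerivAt_mirrorInv hLeg hH (z + s • (w - z))
    rw [← hess_conj hLeg hH] at h4
    exact h4.comp_hasDerivAt s h3
  have h5 := intervalIntegral.integral_eq_sub_of_hasDerivAt (a := (0 : ℝ)) (b := 1)
    (fun s _ => h2 s) ((hcont.clm_apply continuous_const).intervalIntegrable (μ := MeasureTheory.volume) 0 1)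
  simp only [ContinuousLinearMap.apply_apply] at h1
  rw [avgHess, ← h1, h5]
  simp

lemma avgHess_symm (hLeg : IsLegendreKernel D h) (hH : IsHRUC D h ζ) (z w u v : E d) :
    inner ℝ u (avgHess D h z w v) = inner ℝ (avgHess D h z w u) v := by
  rw [real_inner_comm v (avgHess D h z w u), inner_avgHess hLeg hH, inner_avgHess hLeg hH]
  refine intervalIntegral.integral_congr fun s _ => ?_
  rw [inner_hess_conj_symm hLeg hH, real_inner_comm]

lemma continuous_inner_hess_conj_line (hLeg : IsLegendreKernel D h) (hH : IsHRUC D h ζ)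
    (z w v : E d) :
    Continuous fun s : ℝ => inner ℝ v (hess (conj D h) (z + s • (w - z)) v) :=
  continuous_const.inner ((continuous_hess_conj_line hLeg hH z w).clm_apply continuous_const)

lemma line_mem_segment (z w : E d) {s : ℝ} (hs : s ∈ Icc (0 : ℝ) 1) :
    z + s • (w - z) ∈ segment ℝ z w := by
  rw [segment_eq_image']
  exact ⟨s, hs, rfl⟩

lemma le_inner_avgHess (hLeg : IsLegendreKernel D h) (hH : IsHRUC D h ζ) {z w v : E d} {c : ℝ}
    (hc : ∀ ξ ∈ segment ℝ z w, c ≤ inner ℝ v (hess (conj D h) ξ v)) :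
    c ≤ inner ℝ v (avgHess D h z w v) := by
  rw [inner_avgHess hLeg hH]
  have h1 := intervalIntegral.integral_mono_on (a := (0 : ℝ)) (b := 1) zero_le_one
    (f := fun _ => c) intervalIntegrable_const
    ((continuous_inner_hess_conj_line hLeg hH z w v).intervalIntegrable (μ := MeasureTheory.volume) 0 1)
    (fun s hs => hc _ (line_mem_segment z w hs))
  simpa using h1

lemma inner_avgHess_le (hLeg : IsLegendreKernel D h) (hH : IsHRUC D h ζ) {z w v : E d} {c : ℝ}
    (hc : ∀ ξ ∈ segment ℝ z w, inner ℝ v (hess (conj D h) ξ v) ≤ c) :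
    inner ℝ v (avgHess D h z w v) ≤ c := by
  rw [inner_avgHess hLeg hH]
  have h1 := intervalIntegral.integral_mono_on (a := (0 : ℝ)) (b := 1) zero_le_one
    (g := fun _ => c)
    ((continuous_inner_hess_conj_line hLeg hH z w v).intervalIntegrable (μ := MeasureTheory.volume) 0 1) intervalIntegrable_const
    (fun s hs => hc _ (line_mem_segment z w hs))
  simpa using h1

lemma avgHess_nonneg (hLeg : IsLegendreKernel D h) (hH : IsHRUC D h ζ) (z w v : E d) :
    0 ≤ inner ℝ v (avgHess D h z w v) :=
  le_inner_avgHess hLeg hH fun ξ _ => inner_hess_conj_nonneg hLeg hH ξ v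

/-- Averages over two segments with mutual distance at most `r` are comparable. -/
lemma inner_avgHess_le_avgHess (hLeg : IsLegendreKernel D h) (hH : IsHRUC D h ζ)
    {z w z' w' : E d} {r : ℝ} (hr0 : 0 ≤ r)
    (hr : ∀ ξ ∈ segment ℝ z w, ∀ ξ' ∈ segment ℝ z' w', ‖ξ' - ξ‖ ≤ r) (v : E d) :
    inner ℝ v (avgHess D h z' w' v) ≤ (1 + ζ r) * inner ℝ v (avgHess D h z w v) := by
  have hpos : 0 < 1 + ζ r := by linarith [hH.modulus_nonneg hr0]
  refine inner_avgHess_le hLeg hH fun ξ' hξ' => ?_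
  rw [← div_le_iff₀' hpos]
  refine le_inner_avgHess hLeg hH fun ξ hξ => ?_
  rw [div_le_iff₀' hpos]
  exact inner_hess_conj_le hLeg hH (hr ξ hξ ξ' hξ') v

/-- A quadratic form bounded by `L` times a positive semidefinite form `H`, evaluated in the norm
dual to `H`. -/
lemma inner_apply_le_of_abs_le {F H A : E d →L[ℝ] E d} {L : ℝ} (hL : 0 < L)
    (hF : ∀ u v, inner ℝ u (F v) = inner ℝ (F u) v)
    (hA : ∀ u v, inner ℝ u (A v) = inner ℝ (A u) v)
    (hHA : ∀ v, H (A v) = v)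
    (hFH : ∀ v, |inner ℝ v (F v)| ≤ L * inner ℝ v (H v)) (v : E d) :
    inner ℝ (F (A v)) (A (F (A v))) ≤ L ^ 2 * inner ℝ v (A v) := by
  set u := F (A v) with hu
  -- Polarization: at a ± b with a = A v, b = L⁻¹ A u, the difference of the F forms is 4 L⁻¹ ⟨u, A
  -- u⟩, and the parallelogram law for H bounds it by 2 L ⟨v, A v⟩ + 2 L⁻¹ ⟨u, A u⟩.
  have h1 := hFH (A v + L⁻¹ • A u)
  have h2 := hFH (A v - L⁻¹ • A u)
  have e1 : inner ℝ (A v) u = inner ℝ (A v) (F (A v)) := by rw [hu]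
  have e2 : inner ℝ (A v) (F (A u)) = inner ℝ u (A u) := by rw [hF, ← hu]
  have e3 : inner ℝ (A u) u = inner ℝ u (A u) := real_inner_comm _ _
  have e4 : inner ℝ (A v) v = inner ℝ v (A v) := real_inner_comm _ _
  have e5 : inner ℝ (A u) v = inner ℝ (A v) u := by rw [← hA, real_inner_comm]
  simp only [map_add, map_sub, map_smul, inner_add_left, inner_add_right, inner_sub_left,
    inner_sub_right, inner_smul_left, inner_smul_right, conj_trivial, hHA, ← hu, e2, e3, e4,
    e5] at h1 h2
  have h3 := (le_abs_self _).trans h1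
  have h4 := (neg_le_abs _).trans h2
  have hi : L * L⁻¹ = 1 := mul_inv_cancel₀ hL.ne'
  set X := inner ℝ u (A u)
  have h5 : 4 * (L⁻¹ * X) ≤ 2 * (L * inner ℝ v (A v)) + 2 * (L * L⁻¹) * (L⁻¹ * X) := by
    ring_nf at h3 h4 ⊢
    linarith
  rw [hi] at h5
  have h6 : L * (L⁻¹ * X) ≤ L * (L * inner ℝ v (A v)) :=
    mul_le_mul_of_nonneg_left (by linarith) hL.le
  rw [← mul_assoc, hi, one_mul] at h6
  linarith

/-- Relative smoothness makes the gradient in dual coordinates Lipschitz in a local norm. -/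
theorem norm_gradient_mirrorInv_sub_le (hLeg : IsLegendreKernel D h) (hH : IsHRUC D h ζ)
    {f : E d → ℝ} {L lm : ℝ} (hL : 0 < L) (hlm : 0 ≤ lm) (hs : IsRelSmooth D h L f)
    (hf : ContDiffOn ℝ 2 f (interior D)) {P B : E d →L[ℝ] E d}
    (hB : ∀ u v, inner ℝ u (P v) = inner ℝ (B u) (B v)) {z w : E d}
    (h1 : ∀ ξ ∈ segment ℝ z w, ∀ v,
      inner ℝ v (P v) ≤ lm * inner ℝ v (hess (conj D h) ξ v))
    (h2 : ∀ ξ ∈ segment ℝ z w, ∀ v,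
      inner ℝ v (hess (conj D h) ξ v) ≤ lm * inner ℝ v (P v)) :
    ‖B (gradient f (mirrorInv D h w) - gradient f (mirrorInv D h z))‖ ≤ lm * L * ‖B (w - z)‖ := by
  have hder : ∀ s : ℝ, HasDerivAt
      (fun s : ℝ => B (gradient f (mirrorInv D h (z + s • (w - z)))))
      (B (hess f (mirrorInv D h (z + s • (w - z)))
        (hess (conj D h) (z + s • (w - z)) (w - z)))) s := by
    intro s
    have h3 : HasDerivAt (fun s : ℝ => z + s • (w - z)) (w - z) s := by
      simpa using ((hasDerivAt_id s).smul_const (w - z)).const_add z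
    have h4 := hasFDerivAt_mirrorInv hLeg hH (z + s • (w - z))
    rw [← hess_conj hLeg hH] at h4
    have h5 := hasFDerivAt_gradient isOpen_interior hf (mirrorInv_mem hLeg hH (z + s • (w - z)))
    have h6 : HasDerivAt (fun s : ℝ => mirrorInv D h (z + s • (w - z)))
        (hess (conj D h) (z + s • (w - z)) (w - z)) s := h4.comp_hasDerivAt s h3
    have h7 : HasDerivAt (fun s : ℝ => gradient f (mirrorInv D h (z + s • (w - z))))
        (hess f (mirrorInv D h (z + s • (w - z)))
          (hess (conj D h) (z + s • (w - z)) (w - z))) s :=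
      HasFDerivAt.comp_hasDerivAt (l := gradient f) s h5 h6
    exact B.hasFDerivAt.comp_hasDerivAt s h7
  have hBsq : ∀ v, ‖B v‖ ^ 2 = inner ℝ v (P v) := fun v => by
    rw [hB, real_inner_self_eq_norm_sq]
  have hbound : ∀ s ∈ Ico (0 : ℝ) 1, ‖B (hess f (mirrorInv D h (z + s • (w - z)))
      (hess (conj D h) (z + s • (w - z)) (w - z)))‖ ≤ lm * L * ‖B (w - z)‖ := by
    intro s hs'
    have hmem := line_mem_segment z w ⟨hs'.1, hs'.2.le⟩
    set ξ := z + s • (w - z)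
    have hm := mirrorInv_mem hLeg hH ξ
    refine abs_le_of_sq_le_sq' ?_ (by positivity) |>.2
    have h6 := inner_apply_le_of_abs_le hL (inner_hess_symm isOpen_interior hf hm)
      (inner_hess_conj_symm hLeg hH ξ) (hess_hess_conj hLeg hH ξ)
      (hs.abs_inner_hess_le hLeg.contDiff hf hm) (w - z)
    rw [hBsq, mul_pow, hBsq]
    -- One factor `lm` is paid to pass from P to A at the current point and one to return; after the
    -- square root this leaves `lm * L`.
    calc _ ≤ lm * _ := h1 ξ hmem _
      _ ≤ lm * (L ^ 2 * inner ℝ (w - z) (hess (conj D h) ξ (w - z))) :=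
        mul_le_mul_of_nonneg_left h6 hlm
      _ ≤ lm * (L ^ 2 * (lm * inner ℝ (w - z) (P (w - z)))) := by
        gcongr
        exact h2 ξ hmem _
      _ = _ := by ring
  have h7 := norm_image_sub_le_of_norm_deriv_le_segment_01'
    (fun s _ => (hder s).hasDerivWithinAt) hbound
  simpa using h7

end LocalNorms

/-! ### Consensus estimates for the weight matrix and the arithmetic of the Lyapunov weights. -/

section Mixing

variable {m d : ℕ} {W : Matrix (Fin m) (Fin m) ℝ}

/-- Mixing of the agents' vectors by the weight matrix. -/
def mix (W : Matrix (Fin m) (Fin m) ℝ) (v : Fin m → E d) (i : Fin m) : E d :=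
  ∑ j, W i j • v j

lemma avg_add (u v : Fin m → E d) : avg (fun i => u i + v i) = avg u + avg v := by
  simp [avg, Finset.sum_add_distrib]

lemma avg_sub (u v : Fin m → E d) : avg (fun i => u i - v i) = avg u - avg v := by
  simp [avg, Finset.sum_sub_distrib, smul_sub]

lemma avg_const (hm : 0 < m) (v : E d) : avg (fun _ : Fin m => v) = v := by
  have : (m : ℝ) ≠ 0 := by positivity
  simp [avg, ← Nat.cast_smul_eq_nsmul ℝ, smul_smul, this]

lemma sum_eq_smul_avg (hm : 0 < m) (v : Fin m → E d) : ∑ i, v i = (m : ℝ) • avg v := by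
  have : (m : ℝ) ≠ 0 := by positivity
  simp [avg, smul_smul, this]

lemma map_avg (B : E d →L[ℝ] E d) (v : Fin m → E d) : B (avg v) = avg fun i => B (v i) := by
  simp [avg]

lemma map_mix (B : E d →L[ℝ] E d) (v : Fin m → E d) (i : Fin m) :
    B (mix W v i) = mix W (fun i => B (v i)) i := by
  simp [mix]

lemma mix_sub (u v : Fin m → E d) (i : Fin m) :
    mix W (fun i => u i - v i) i = mix W u i - mix W v i := by
  simp [mix, Finset.sum_sub_distrib, smul_sub]

lemma mix_const (hW : W ∈ doublyStochastic ℝ (Fin m)) (v : E d) (i : Fin m) :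
    mix W (fun _ => v) i = v := by
  rw [mix, ← Finset.sum_smul, sum_row_of_mem_doublyStochastic hW, one_smul]

lemma avg_mix (hW : W ∈ doublyStochastic ℝ (Fin m)) (v : Fin m → E d) :
    avg (mix W v) = avg v := by
  simp only [avg, mix]
  rw [Finset.sum_comm]
  simp_rw [← Finset.sum_smul, sum_col_of_mem_doublyStochastic hW, one_smul]

lemma sum_norm_sub_avg_sq (hm : 0 < m) (v : Fin m → E d) :
    ∑ i, ‖v i - avg v‖ ^ 2 = ∑ i, ‖v i‖ ^ 2 - m * ‖avg v‖ ^ 2 := by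
  have h1 : ∑ i, inner ℝ (v i) (avg v) = m * ‖avg v‖ ^ 2 := by
    rw [← sum_inner, sum_eq_smul_avg hm, inner_smul_left, real_inner_self_eq_norm_sq, conj_trivial]
  simp_rw [norm_sub_sq_real, Finset.sum_add_distrib, Finset.sum_sub_distrib, ← Finset.mul_sum, h1]
  simp
  ring

lemma sum_norm_sub_avg_sq_le (hm : 0 < m) (v : Fin m → E d) :
    ∑ i, ‖v i - avg v‖ ^ 2 ≤ ∑ i, ‖v i‖ ^ 2 := by
  rw [sum_norm_sub_avg_sq hm]
  have : 0 ≤ (m : ℝ) * ‖avg v‖ ^ 2 := by positivity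
  linarith

lemma norm_avg_sq_le (hm : 0 < m) (v : Fin m → E d) :
    m * ‖avg v‖ ^ 2 ≤ ∑ i, ‖v i‖ ^ 2 := by
  have h1 := sum_norm_sub_avg_sq hm v
  have h2 : 0 ≤ ∑ i, ‖v i - avg v‖ ^ 2 := Finset.sum_nonneg fun i _ => by positivity
  linarith

lemma norm_avg_le (hm : 0 < m) {v : Fin m → E d} {δ : ℝ} (hv : ∀ i, ‖v i‖ ≤ δ) :
    ‖avg v‖ ≤ δ := by
  have hm' : (0 : ℝ) < m := by positivity
  rw [avg, norm_smul, Real.norm_eq_abs, abs_of_pos (by positivity), one_div, inv_mul_le_iff₀ hm']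
  exact (norm_sum_le _ _).trans (by simpa using Finset.sum_le_sum fun i (_ : i ∈ Finset.univ) => hv i)

lemma mixingRate_nonneg : 0 ≤ mixingRate W := norm_nonneg _

/-- The matrix acts on each coordinate of the agents' vectors separately, so this is the spectral
norm bound summed over the coordinates. -/
lemma sum_norm_mix_sub_avg_sq_le (v : Fin m → E d) :
    ∑ i, ‖mix W v i - avg v‖ ^ 2 ≤ mixingRate W ^ 2 * ∑ i, ‖v i‖ ^ 2 := by
  simp_rw [EuclideanSpace.norm_sq_eq]
  rw [Finset.sum_comm, Finset.sum_comm (f := fun i k => ‖v i k‖ ^ 2), Finset.mul_sum]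
  refine Finset.sum_le_sum fun k _ => ?_
  set T := Matrix.toEuclideanCLM (n := Fin m) (𝕜 := ℝ) (W - Matrix.of fun _ _ => 1 / (m : ℝ))
    with hT
  set u : EuclideanSpace ℝ (Fin m) := WithLp.toLp 2 fun j => v j k with hu
  have h1 : ∀ i, (mix W v i - avg v) k = (T u) i := by
    intro i
    have : (T u) i = ((W - Matrix.of fun _ _ => 1 / (m : ℝ)).mulVec fun j => v j k) i := rfl
    rw [this]
    simp [mix, avg, Matrix.mulVec, dotProduct, sub_mul, Finset.sum_sub_distrib, Finset.mul_sum]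
  have h2 : ∑ i, ‖(mix W v i - avg v) k‖ ^ 2 = ‖T u‖ ^ 2 := by
    rw [EuclideanSpace.norm_sq_eq]
    simp_rw [h1]
  have h3 : ∑ i, ‖v i k‖ ^ 2 = ‖u‖ ^ 2 := by
    rw [EuclideanSpace.norm_sq_eq]
  rw [h2, h3, ← mul_pow]
  exact pow_le_pow_left₀ (norm_nonneg _) (T.le_opNorm u) 2

/-- Jensen for each row, then the column sums are one. -/
lemma sum_norm_mix_sq_le (hW : W ∈ doublyStochastic ℝ (Fin m)) (v : Fin m → E d) :
    ∑ i, ‖mix W v i‖ ^ 2 ≤ ∑ i, ‖v i‖ ^ 2 := by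
  have hconv : ConvexOn ℝ univ fun x : E d => ‖x‖ ^ 2 :=
    convexOn_univ_norm.pow (fun _ _ => norm_nonneg _) 2
  have h1 : ∀ i, ‖mix W v i‖ ^ 2 ≤ ∑ j, W i j * ‖v j‖ ^ 2 := fun i => by
    simpa [mix] using hconv.map_sum_le (t := Finset.univ) (w := fun j => W i j) (p := v)
      (fun j _ => nonneg_of_mem_doublyStochastic hW) (sum_row_of_mem_doublyStochastic hW i)
      (fun _ _ => mem_univ _)
  refine (Finset.sum_le_sum fun i _ => h1 i).trans_eq ?_
  rw [Finset.sum_comm]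
  simp_rw [← Finset.sum_mul, sum_col_of_mem_doublyStochastic hW, one_mul]

/-- Young's weights 1 + a and 1 + 1/a with a = (1 - ρ)/(1 + ρ), chosen so that ρ (1 + a) ≤ 1 - (1 -
ρ)/2. -/
lemma norm_add_sq_le_young {ρ : ℝ} (h0 : 0 ≤ ρ) (h1 : ρ < 1) (a b : E d) :
    ‖a + b‖ ^ 2 ≤ 2 / (1 + ρ) * ‖a‖ ^ 2 + 2 / (1 - ρ) * ‖b‖ ^ 2 := by
  have hp : 0 < 1 + ρ := by linarith
  have hq : 0 < 1 - ρ := by linarith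
  have h2 : ‖a + b‖ ^ 2 ≤ (‖a‖ + ‖b‖) ^ 2 :=
    pow_le_pow_left₀ (norm_nonneg _) (norm_add_le a b) 2
  refine h2.trans ?_
  rw [div_mul_eq_mul_div, div_mul_eq_mul_div, div_add_div _ _ hp.ne' hq.ne',
    le_div_iff₀ (mul_pos hp hq)]
  nlinarith [sq_nonneg ((1 - ρ) * ‖a‖ - (1 + ρ) * ‖b‖)]

/-- Changing the local norm costs κ; the condition on ζ(2δ) makes it consume at most one of the two
factors ρ of the squared contraction. -/
lemma modulus_mul_sq_le {ρ κ : ℝ} (h0 : 0 ≤ ρ) (h1 : ρ < 1) (hκ : κ ≤ 1 + (1 - ρ) / 2) :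
    κ * ρ ^ 2 ≤ ρ := by
  have h2 : κ * ρ ^ 2 ≤ (1 + (1 - ρ) / 2) * ρ ^ 2 :=
    mul_le_mul_of_nonneg_right hκ (sq_nonneg ρ)
  nlinarith [mul_nonneg h0 (mul_nonneg (sub_nonneg.2 h1.le) (by linarith : 0 ≤ 2 - ρ))]

lemma mul_two_div_le {ρ : ℝ} (h0 : 0 ≤ ρ) : ρ * (2 / (1 + ρ)) ≤ 1 - (1 - ρ) / 2 := by
  rw [mul_div_assoc', div_le_iff₀ (by linarith)]
  nlinarith [sq_nonneg (1 - ρ)]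

/-- Change of the consensus error of the dual variables in one iteration, in local norms. -/
lemma consensus_step (hm : 0 < m) (hW : W ∈ doublyStochastic ℝ (Fin m)) (hρ : mixingRate W < 1)
    {B B' : E d →L[ℝ] E d} {κ : ℝ} (hκ0 : 0 ≤ κ) (hκ : κ ≤ 1 + (1 - mixingRate W) / 2)
    (hB : ∀ v, ‖B' v‖ ^ 2 ≤ κ * ‖B v‖ ^ 2) (z c : Fin m → E d) :
    ∑ i, ‖B' (mix W (fun j => z j - c j) i - avg (mix W fun j => z j - c j))‖ ^ 2 ≤
      (1 - (1 - mixingRate W) / 2) * ∑ i, ‖B (z i - avg z)‖ ^ 2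
        + 2 / (1 - mixingRate W) * ∑ i, ‖B (c i)‖ ^ 2 := by
  have hρ0 : 0 ≤ mixingRate W := mixingRate_nonneg
  set ρ := mixingRate W
  -- Mixing fixes constant vectors, so `z` may be centred first.
  set x : Fin m → E d := fun i => (z i - avg z) - c i with hx
  have h1 : ∀ i, mix W (fun j => z j - c j) i - avg (mix W fun j => z j - c j) =
      mix W x i - avg x := by
    intro i
    rw [avg_mix hW, hx, mix_sub, mix_sub, mix_sub, mix_const hW, avg_sub, avg_sub, avg_sub,
      avg_const hm]
    abel
  have h2 : ∑ i, ‖B (mix W x i - avg x)‖ ^ 2 ≤ ρ ^ 2 * ∑ i, ‖B (x i)‖ ^ 2 := by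
    simp_rw [map_sub, map_mix, map_avg]
    exact sum_norm_mix_sub_avg_sq_le fun i => B (x i)
  have h3 : ∑ i, ‖B (x i)‖ ^ 2 ≤ 2 / (1 + ρ) * ∑ i, ‖B (z i - avg z)‖ ^ 2
      + 2 / (1 - ρ) * ∑ i, ‖B (c i)‖ ^ 2 := by
    rw [Finset.mul_sum, Finset.mul_sum, ← Finset.sum_add_distrib]
    refine Finset.sum_le_sum fun i _ => ?_
    have := norm_add_sq_le_young hρ0 hρ (B (z i - avg z)) (-B (c i))
    rwa [norm_neg, ← sub_eq_add_neg, ← map_sub] at this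
  have hE : 0 ≤ ∑ i, ‖B (z i - avg z)‖ ^ 2 := Finset.sum_nonneg fun i _ => by positivity
  have hS : 0 ≤ ∑ i, ‖B (c i)‖ ^ 2 := Finset.sum_nonneg fun i _ => by positivity
  have hσ : 0 < 1 - ρ := by linarith
  calc _ ≤ κ * ∑ i, ‖B (mix W x i - avg x)‖ ^ 2 := by
        rw [Finset.mul_sum]
        exact Finset.sum_le_sum fun i _ => by rw [h1]; exact hB _
    _ ≤ κ * (ρ ^ 2 * ∑ i, ‖B (x i)‖ ^ 2) := mul_le_mul_of_nonneg_left h2 hκ0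
    _ = κ * ρ ^ 2 * ∑ i, ‖B (x i)‖ ^ 2 := by ring
    _ ≤ ρ * (2 / (1 + ρ) * ∑ i, ‖B (z i - avg z)‖ ^ 2 + 2 / (1 - ρ) * ∑ i, ‖B (c i)‖ ^ 2) :=
        mul_le_mul (modulus_mul_sq_le hρ0 hρ hκ) h3
          (Finset.sum_nonneg fun i _ => by positivity) hρ0
    _ = ρ * (2 / (1 + ρ)) * ∑ i, ‖B (z i - avg z)‖ ^ 2
        + ρ * (2 / (1 - ρ) * ∑ i, ‖B (c i)‖ ^ 2) := by ring
    _ ≤ _ := add_le_add (mul_le_mul_of_nonneg_right (mul_two_div_le hρ0) hE)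
        (mul_le_of_le_one_left (by positivity) hρ.le)

/-- Change of the consensus error of the gradient trackers in one iteration, in local norms. -/
lemma tracker_step (hm : 0 < m) (hW : W ∈ doublyStochastic ℝ (Fin m)) (hρ : mixingRate W < 1)
    {B B' : E d →L[ℝ] E d} {κ : ℝ} (hκ0 : 0 ≤ κ) (hκ : κ ≤ 1 + (1 - mixingRate W) / 2)
    (hB : ∀ v, ‖B' v‖ ^ 2 ≤ κ * ‖B v‖ ^ 2) (y e : Fin m → E d) :
    ∑ i, ‖B' (mix W y i + e i - avg (fun i => mix W y i + e i))‖ ^ 2 ≤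
      (1 - (1 - mixingRate W) / 2) * ∑ i, ‖B (y i - avg y)‖ ^ 2
        + 3 / (1 - mixingRate W) * ∑ i, ‖B (e i)‖ ^ 2 := by
  have hρ0 : 0 ≤ mixingRate W := mixingRate_nonneg
  set ρ := mixingRate W
  have hσ : 0 < 1 - ρ := by linarith
  set x : Fin m → E d := fun i => y i - avg y with hx
  have hx0 : avg x = 0 := by rw [hx, avg_sub, avg_const hm, sub_self]
  have h1 : ∀ i, mix W y i + e i - avg (fun i => mix W y i + e i) =
      mix W x i + (e i - avg e) := by
    intro i
    have h2 : avg (fun i => mix W y i + e i) = avg y + avg e := by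
      rw [avg_add]
      congr 1
      exact avg_mix hW y
    rw [h2, hx, mix_sub, mix_const hW]
    abel
  have h2 : ∑ i, ‖B (mix W x i)‖ ^ 2 ≤ ρ ^ 2 * ∑ i, ‖B (x i)‖ ^ 2 := by
    have h3 := sum_norm_mix_sub_avg_sq_le (W := W) fun i => B (x i)
    rw [← map_avg, hx0, map_zero] at h3
    simpa [map_mix] using h3
  have h3 : ∑ i, ‖B (e i - avg e)‖ ^ 2 ≤ ∑ i, ‖B (e i)‖ ^ 2 := by
    simp_rw [map_sub, map_avg]
    exact sum_norm_sub_avg_sq_le hm fun i => B (e i)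
  have hU : 0 ≤ ∑ i, ‖B (x i)‖ ^ 2 := Finset.sum_nonneg fun i _ => by positivity
  have hS : 0 ≤ ∑ i, ‖B (e i)‖ ^ 2 := Finset.sum_nonneg fun i _ => by positivity
  -- Here κ ≤ 3/2, since ρ ≥ 0. The perturbation enters after mixing, so no factor ρ helps.
  have hκ' : κ * (2 / (1 - ρ)) ≤ 3 / (1 - ρ) := by
    rw [mul_div_assoc']
    exact div_le_div_of_nonneg_right (by linarith) hσ.le
  calc _ ≤ κ * ∑ i, (2 / (1 + ρ) * ‖B (mix W x i)‖ ^ 2 + 2 / (1 - ρ) * ‖B (e i - avg e)‖ ^ 2) := by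
        rw [Finset.mul_sum]
        refine Finset.sum_le_sum fun i _ => ?_
        rw [h1]
        refine (hB _).trans (mul_le_mul_of_nonneg_left ?_ hκ0)
        rw [map_add]
        exact norm_add_sq_le_young hρ0 hρ _ _
    _ = 2 / (1 + ρ) * κ * ∑ i, ‖B (mix W x i)‖ ^ 2
        + κ * (2 / (1 - ρ)) * ∑ i, ‖B (e i - avg e)‖ ^ 2 := by
        rw [Finset.sum_add_distrib, ← Finset.mul_sum, ← Finset.mul_sum]
        ring
    _ ≤ 2 / (1 + ρ) * κ * (ρ ^ 2 * ∑ i, ‖B (x i)‖ ^ 2) + 3 / (1 - ρ) * ∑ i, ‖B (e i)‖ ^ 2 := by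
        gcongr
    _ = (κ * ρ ^ 2) * (2 / (1 + ρ)) * ∑ i, ‖B (x i)‖ ^ 2 + 3 / (1 - ρ) * ∑ i, ‖B (e i)‖ ^ 2 := by
        ring
    _ ≤ _ := by
        refine add_le_add_left (mul_le_mul_of_nonneg_right ?_ hU) _
        exact (mul_le_mul_of_nonneg_right (modulus_mul_sq_le hρ0 hρ hκ) (by positivity)).trans
          (mul_two_div_le hρ0)

/-- Size of one dual step. -/
lemma increment_le (hW : W ∈ doublyStochastic ℝ (Fin m)) (B : E d →L[ℝ] E d)
    (z c : Fin m → E d) :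
    ∑ i, ‖B (mix W (fun j => z j - c j) i - z i)‖ ^ 2 ≤
      6 * ∑ i, ‖B (z i - avg z)‖ ^ 2 + 4 * ∑ i, ‖B (c i)‖ ^ 2 := by
  have hpar : ∀ a b : E d, ‖a - b‖ ^ 2 ≤ 2 * ‖a‖ ^ 2 + 2 * ‖b‖ ^ 2 := fun a b => by
    have := parallelogram_law_with_norm ℝ a b
    nlinarith [sq_nonneg ‖a + b‖]
  set x : Fin m → E d := fun i => (z i - avg z) - c i with hx
  have h1 : ∀ i, mix W (fun j => z j - c j) i - z i = mix W x i - (z i - avg z) := by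
    intro i
    rw [hx, mix_sub, mix_sub, mix_sub, mix_const hW]
    abel
  have h2 : ∑ i, ‖B (mix W x i)‖ ^ 2 ≤ ∑ i, ‖B (x i)‖ ^ 2 := by
    simp_rw [map_mix]
    exact sum_norm_mix_sq_le hW fun i => B (x i)
  have h3 : ∑ i, ‖B (x i)‖ ^ 2 ≤ 2 * ∑ i, ‖B (z i - avg z)‖ ^ 2 + 2 * ∑ i, ‖B (c i)‖ ^ 2 := by
    rw [Finset.mul_sum, Finset.mul_sum, ← Finset.sum_add_distrib]
    refine Finset.sum_le_sum fun i _ => ?_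
    rw [hx, map_sub]
    exact hpar _ _
  have h4 : ∑ i, ‖B (mix W (fun j => z j - c j) i - z i)‖ ^ 2 ≤
      2 * ∑ i, ‖B (mix W x i)‖ ^ 2 + 2 * ∑ i, ‖B (z i - avg z)‖ ^ 2 := by
    rw [Finset.mul_sum, Finset.mul_sum, ← Finset.sum_add_distrib]
    refine Finset.sum_le_sum fun i _ => ?_
    rw [h1, map_sub]
    exact hpar _ _
  linarith

/-- Euclidean consensus error of the dual variables under bounded steps. -/
lemma sum_norm_consensus_le (hm : 0 < m) (hW : W ∈ doublyStochastic ℝ (Fin m))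
    (hρ : mixingRate W < 1) {δ : ℝ} {z c : Fin m → E d} (hc : ∀ i, ‖c i‖ ≤ δ)
    (hz : ∑ i, ‖z i - avg z‖ ^ 2 ≤ m * (mixingRate W / (1 - mixingRate W) * δ) ^ 2) :
    ∑ i, ‖mix W (fun j => z j - c j) i - avg (mix W fun j => z j - c j)‖ ^ 2 ≤
      m * (mixingRate W / (1 - mixingRate W) * δ) ^ 2 := by
  have hρ0 : 0 ≤ mixingRate W := mixingRate_nonneg
  set ρ := mixingRate W
  have hσ : 0 < 1 - ρ := by linarith
  set x : Fin m → E d := fun i => (z i - avg z) - c i with hx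
  have h1 : ∀ i, mix W (fun j => z j - c j) i - avg (mix W fun j => z j - c j) =
      mix W x i - avg x := by
    intro i
    rw [avg_mix hW, hx, mix_sub, mix_sub, mix_sub, mix_const hW, avg_sub, avg_sub, avg_sub,
      avg_const hm]
    abel
  have h2 : ∀ i, ρ ^ 2 * ‖x i‖ ^ 2 ≤ ρ * ‖z i - avg z‖ ^ 2 + ρ ^ 2 / (1 - ρ) * δ ^ 2 := by
    intro i
    have h3 : ‖x i‖ ≤ ‖z i - avg z‖ + δ := (norm_sub_le _ _).trans (by linarith [hc i])
    have h4 : ‖x i‖ ^ 2 ≤ (‖z i - avg z‖ + δ) ^ 2 := pow_le_pow_left₀ (norm_nonneg _) h3 2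
    -- Young with weights that are sharp at the radius r = ρδ/(1 - ρ), the fixed point of r = ρ (r +
    -- δ); hence the bound reproduces itself.
    have h5 : ρ * (1 - ρ) * (‖z i - avg z‖ + δ) ^ 2 ≤
        (1 - ρ) * ‖z i - avg z‖ ^ 2 + ρ * δ ^ 2 := by
      nlinarith [sq_nonneg ((1 - ρ) * ‖z i - avg z‖ - ρ * δ)]
    have h6 : ρ * (‖z i - avg z‖ + δ) ^ 2 ≤ ‖z i - avg z‖ ^ 2 + ρ / (1 - ρ) * δ ^ 2 := by
      have h7 : ‖z i - avg z‖ ^ 2 + ρ / (1 - ρ) * δ ^ 2 =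
          ((1 - ρ) * ‖z i - avg z‖ ^ 2 + ρ * δ ^ 2) / (1 - ρ) := by
        field_simp
      rw [h7, le_div_iff₀ hσ]
      linarith
    calc ρ ^ 2 * ‖x i‖ ^ 2 ≤ ρ ^ 2 * (‖z i - avg z‖ + δ) ^ 2 := by gcongr
      _ = ρ * (ρ * (‖z i - avg z‖ + δ) ^ 2) := by ring
      _ ≤ ρ * (‖z i - avg z‖ ^ 2 + ρ / (1 - ρ) * δ ^ 2) := mul_le_mul_of_nonneg_left h6 hρ0
      _ = _ := by ring
  calc _ = ∑ i, ‖mix W x i - avg x‖ ^ 2 := by simp_rw [h1]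
    _ ≤ ρ ^ 2 * ∑ i, ‖x i‖ ^ 2 := sum_norm_mix_sub_avg_sq_le x
    _ ≤ ∑ i, (ρ * ‖z i - avg z‖ ^ 2 + ρ ^ 2 / (1 - ρ) * δ ^ 2) := by
        rw [Finset.mul_sum]
        exact Finset.sum_le_sum fun i _ => h2 i
    _ = ρ * ∑ i, ‖z i - avg z‖ ^ 2 + m * (ρ ^ 2 / (1 - ρ) * δ ^ 2) := by
        rw [Finset.sum_add_distrib, ← Finset.mul_sum]
        simp
    _ ≤ ρ * (m * (ρ / (1 - ρ) * δ) ^ 2) + m * (ρ ^ 2 / (1 - ρ) * δ ^ 2) := by gcongr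
    _ = _ := by
        field_simp
        ring

/-- The first-order term of the descent inequality. -/
lemma inner_avg_lower (hm : 0 < m) {B : E d →L[ℝ] E d} {η w : ℝ} (hη : 0 < η) (hw : 0 < w)
    {y c g g₀ : Fin m → E d} {θ : Fin m → ℝ} (hθ0 : ∀ i, 0 ≤ θ i) (hθ : ∀ i, θ i ≤ η)
    (hc : ∀ i, c i = θ i • y i) (hyg : avg y = avg g) :
    3 / 4 * η⁻¹ * ∑ i, ‖B (c i)‖ ^ 2 - η * ∑ i, ‖B (y i - avg y)‖ ^ 2
      - (w⁻¹ / 4 * ∑ i, ‖B (g₀ i - g i)‖ ^ 2 + w * ∑ i, ‖B (c i)‖ ^ 2) ≤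
      m * inner ℝ (B (avg g₀)) (B (avg c)) := by
  have hηi : η * η⁻¹ = 1 := mul_inv_cancel₀ hη.ne'
  have hwi : w * w⁻¹ = 1 := mul_inv_cancel₀ hw.ne'
  have h1 : m * inner ℝ (B (avg y)) (B (avg c)) = ∑ i, inner ℝ (B (avg y)) (B (c i)) := by
    rw [← inner_sum, ← map_sum, sum_eq_smul_avg hm, map_smul, inner_smul_right]
  have h2 : ∀ i, 3 / 4 * η⁻¹ * ‖B (c i)‖ ^ 2 - η * ‖B (y i - avg y)‖ ^ 2 ≤
      inner ℝ (B (avg y)) (B (c i)) := by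
    intro i
    have h3 : inner ℝ (B (avg y)) (B (c i)) =
        inner ℝ (B (y i)) (B (c i)) - inner ℝ (B (y i - avg y)) (B (c i)) := by
      rw [map_sub, inner_sub_left]
      ring
    -- Clipping only shortens η y, so `c i = θ i • y i` with θ ≤ η; a shorter step only improves
    -- this inequality.
    have h4 : η⁻¹ * ‖B (c i)‖ ^ 2 ≤ inner ℝ (B (y i)) (B (c i)) := by
      rw [inv_mul_le_iff₀ hη, hc, map_smul, norm_smul, inner_smul_right,
        real_inner_self_eq_norm_sq, mul_pow, Real.norm_eq_abs, sq_abs, ← mul_assoc, sq (θ i)]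
      exact mul_le_mul_of_nonneg_right (mul_le_mul_of_nonneg_right (hθ i) (hθ0 i)) (sq_nonneg _)
    have h5 := real_inner_le_norm (B (y i - avg y)) (B (c i))
    have h6 : ‖B (y i - avg y)‖ * ‖B (c i)‖ ≤
        η * ‖B (y i - avg y)‖ ^ 2 + 1 / 4 * η⁻¹ * ‖B (c i)‖ ^ 2 := by
      have h7 : 0 ≤ η⁻¹ * (η * ‖B (y i - avg y)‖ - 1 / 2 * ‖B (c i)‖) ^ 2 := by positivity
      have h8 : η⁻¹ * (η * ‖B (y i - avg y)‖ - 1 / 2 * ‖B (c i)‖) ^ 2 =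
        (η * η⁻¹) * η * ‖B (y i - avg y)‖ ^ 2 - (η * η⁻¹) * ‖B (y i - avg y)‖ * ‖B (c i)‖
          + 1 / 4 * η⁻¹ * ‖B (c i)‖ ^ 2 := by ring
      rw [h8, hηi] at h7
      linarith
    rw [h3]
    linarith
  have h3 : 3 / 4 * η⁻¹ * ∑ i, ‖B (c i)‖ ^ 2 - η * ∑ i, ‖B (y i - avg y)‖ ^ 2 ≤
      m * inner ℝ (B (avg y)) (B (avg c)) := by
    rw [h1, Finset.mul_sum, Finset.mul_sum, ← Finset.sum_sub_distrib]
    exact Finset.sum_le_sum fun i _ => h2 i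
  -- The trackers average the gradients at the agents' own points; the gradient at the mean differs
  -- by `p`, paid for by Young with weight `w`.
  have h4 : B (avg g₀) = B (avg y) + avg fun i => B (g₀ i - g i) := by
    rw [hyg, ← map_avg, ← map_add, avg_sub]
    congr 1
    abel
  set p := avg fun i => B (g₀ i - g i)
  set q := B (avg c)
  have h5 : m * ‖p‖ ^ 2 ≤ ∑ i, ‖B (g₀ i - g i)‖ ^ 2 := norm_avg_sq_le hm _
  have h6 : m * ‖q‖ ^ 2 ≤ ∑ i, ‖B (c i)‖ ^ 2 := by
    have := norm_avg_sq_le hm fun i => B (c i)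
    rwa [← map_avg] at this
  have h7 : -(w⁻¹ / 4 * ‖p‖ ^ 2 + w * ‖q‖ ^ 2) ≤ inner ℝ p q := by
    have h8 := neg_le_of_abs_le (abs_real_inner_le_norm p q)
    have h9 : 0 ≤ w⁻¹ * (1 / 2 * ‖p‖ - w * ‖q‖) ^ 2 := by positivity
    have h10 : w⁻¹ * (1 / 2 * ‖p‖ - w * ‖q‖) ^ 2 =
        w⁻¹ / 4 * ‖p‖ ^ 2 - (w * w⁻¹) * ‖p‖ * ‖q‖ + (w * w⁻¹) * w * ‖q‖ ^ 2 := by ring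
    rw [h10, hwi] at h9
    linarith
  have hm' : (0 : ℝ) ≤ m := by positivity
  have h8 : -(w⁻¹ / 4 * (m * ‖p‖ ^ 2) + w * (m * ‖q‖ ^ 2)) ≤ m * inner ℝ p q := by
    have := mul_le_mul_of_nonneg_left h7 hm'
    linarith
  have h9 : w⁻¹ / 4 * (m * ‖p‖ ^ 2) ≤ w⁻¹ / 4 * ∑ i, ‖B (g₀ i - g i)‖ ^ 2 := by gcongr
  have h10 : w * (m * ‖q‖ ^ 2) ≤ w * ∑ i, ‖B (c i)‖ ^ 2 := by gcongr
  rw [h4, inner_add_left, mul_add]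
  linarith

/-- Bookkeeping of the constants in the Lyapunov inequality. -/
lemma lyapunov_arith {η σ L lm M F F' U U' S₁ S₁' S Δ Γ : ℝ} (hη : 0 < η) (hσ : 0 < σ)
    (hσ1 : σ ≤ 1) (hL : 0 < L) (hlm : 1 ≤ lm) (hstep : 25 * L * lm ^ 2 * η ≤ σ ^ 2)
    (hE : 0 ≤ S₁) (hS : 0 ≤ S)
    (hE' : S₁' ≤ (1 - σ / 2) * S₁ + 2 / σ * S)
    (hU' : U' ≤ (1 - σ / 2) * U + 3 / σ * Δ) (hΔ : Δ ≤ (lm * L) ^ 2 * (6 * S₁ + 4 * S))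
    (hΓ : Γ ≤ (lm * L) ^ 2 * S₁)
    (hF : M * (F' - F) ≤ -(3 / 4 * η⁻¹ * S - η * U
      - ((σ ^ 2 / (25 * η))⁻¹ / 4 * Γ + σ ^ 2 / (25 * η) * S)) + L * S) :
    M * F' + 2 * η / σ * U' + 3 / 20 * σ / η * S₁' + (12 * η)⁻¹ * S ≤
      M * F + 2 * η / σ * U + 3 / 20 * σ / η * S₁ := by
  have hlm2 : 1 ≤ lm ^ 2 := one_le_pow₀ hlm
  have hσ2 : σ ^ 2 ≤ 1 := pow_le_one₀ hσ.le hσ1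
  have hLη : 25 * L * η ≤ σ ^ 2 := by
    have : 25 * L * η * 1 ≤ 25 * L * η * lm ^ 2 := by gcongr
    linarith
  have hlmL : 625 * η ^ 2 * (lm * L) ^ 2 ≤ σ ^ 2 * σ ^ 2 := by
    have h1 : lm * 1 ≤ lm * lm := by gcongr
    have h2 : 25 * η * (lm * L) ≤ σ ^ 2 := by
      have : 25 * η * L * lm ≤ 25 * η * L * lm ^ 2 := by
        refine mul_le_mul_of_nonneg_left ?_ (by positivity)
        nlinarith
      linarith
    have h3 := mul_le_mul h2 h2 (by positivity) (by positivity)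
    linarith
  -- The step size condition contains `lm ^ 2`; one factor suffices here because `lm ≥ 1`.
  have hK : (lm * L) ^ 2 ≤ σ ^ 4 / (625 * η ^ 2) := by
    rw [le_div_iff₀ (by positivity)]
    nlinarith
  have eE : 3 / 20 * σ / η * S₁' ≤
      3 / 20 * σ / η * S₁ - 3 / 40 * (σ ^ 2 / η) * S₁ + 3 / 10 * η⁻¹ * S := by
    have h1 := mul_le_mul_of_nonneg_left hE' (by positivity : 0 ≤ 3 / 20 * σ / η)
    refine h1.trans_eq ?_
    field_simp
    ring
  have eU : 2 * η / σ * U' ≤ 2 * η / σ * U - η * U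
      + 6 / 625 * (σ ^ 2 / η) * (6 * S₁ + 4 * S) := by
    have h1 := mul_le_mul_of_nonneg_left hU' (by positivity : 0 ≤ 2 * η / σ)
    have h2 : Δ ≤ σ ^ 4 / (625 * η ^ 2) * (6 * S₁ + 4 * S) :=
      hΔ.trans (mul_le_mul_of_nonneg_right hK (by positivity))
    have h3 := mul_le_mul_of_nonneg_left h2 (by positivity : 0 ≤ 2 * η / σ * (3 / σ))
    have h4 : 2 * η / σ * (3 / σ) * (σ ^ 4 / (625 * η ^ 2) * (6 * S₁ + 4 * S)) =
        6 / 625 * (σ ^ 2 / η) * (6 * S₁ + 4 * S) := by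
      field_simp
      ring
    have h5 : 2 * η / σ * ((1 - σ / 2) * U + 3 / σ * Δ) =
        2 * η / σ * U - η * U + 2 * η / σ * (3 / σ) * Δ := by
      field_simp
    rw [h4] at h3
    rw [h5] at h1
    linarith
  have eΓ : (σ ^ 2 / (25 * η))⁻¹ / 4 * Γ ≤ 1 / 100 * (σ ^ 2 / η) * S₁ := by
    have h1 : Γ ≤ σ ^ 4 / (625 * η ^ 2) * S₁ :=
      hΓ.trans (mul_le_mul_of_nonneg_right hK hE)
    have h2 := mul_le_mul_of_nonneg_left h1 (by positivity : 0 ≤ (σ ^ 2 / (25 * η))⁻¹ / 4)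
    refine h2.trans_eq ?_
    field_simp
    ring
  have eη : σ ^ 2 / η ≤ η⁻¹ := by
    rw [div_eq_mul_inv]
    exact mul_le_of_le_one_left (by positivity) hσ2
  have eS : σ ^ 2 / (25 * η) * S ≤ 1 / 25 * η⁻¹ * S := by
    have : σ ^ 2 / (25 * η) = 1 / 25 * (σ ^ 2 / η) := by field_simp
    rw [this]
    gcongr
  have eL : L * S ≤ 1 / 25 * η⁻¹ * S := by
    refine mul_le_mul_of_nonneg_right ?_ hS
    have : L ≤ 1 / 25 * (σ ^ 2 / η) := by
      rw [mul_div_assoc', le_div_iff₀ hη]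
      linarith
    linarith
  have eS' : σ ^ 2 / η * S ≤ η⁻¹ * S := mul_le_mul_of_nonneg_right eη hS
  have eE0 : 0 ≤ σ ^ 2 / η * S₁ := by positivity
  have eS0 : 0 ≤ η⁻¹ * S := by positivity
  have e12 : (12 * η)⁻¹ * S = 1 / 12 * (η⁻¹ * S) := by
    rw [mul_inv]
    ring
  rw [e12]
  -- The weight 2η/σ cancels η U exactly. In units of (σ²/η) S₁: gain 3/40, cost 36/625 + 1/100. In
  -- units of η⁻¹ S: gain 3/4, cost 3/10 + 24/625 + 1/25 + 1/25, leaving more than 1/12.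
  nlinarith

end Mixing

/-! ### The clipping operator. -/

section Clip

variable {d : ℕ} {η δ : ℝ}

lemma norm_clip_le (hη : 0 < η) (hδ : 0 < δ) (v : E d) : ‖clip η δ v‖ ≤ δ := by
  unfold clip
  split_ifs with hv
  · rwa [norm_smul, Real.norm_eq_abs, abs_of_pos hη]
  · have hv0 : ‖v‖ ≠ 0 := by
      intro h0
      rw [h0, mul_zero] at hv
      exact hv hδ.le
    rw [norm_smul, Real.norm_eq_abs, abs_of_nonneg (by positivity), div_mul_cancel₀ _ hv0]

lemma norm_clip_of_ne (hδ : 0 < δ) {v : E d} (hne : clip η δ v ≠ η • v) : ‖clip η δ v‖ = δ := by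
  unfold clip at hne ⊢
  split_ifs at hne ⊢ with hv
  · exact absurd rfl hne
  · have hv0 : ‖v‖ ≠ 0 := by
      intro h0
      rw [h0, mul_zero] at hv
      exact hv hδ.le
    rw [norm_smul, Real.norm_eq_abs, abs_of_nonneg (by positivity), div_mul_cancel₀ _ hv0]

lemma exists_clip_eq_smul (hη : 0 < η) (hδ : 0 < δ) (v : E d) :
    ∃ θ : ℝ, 0 ≤ θ ∧ θ ≤ η ∧ clip η δ v = θ • v := by
  unfold clip
  split_ifs with hv
  · exact ⟨η, hη.le, le_rfl, rfl⟩
  · have hv0 : 0 < ‖v‖ := by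
      refine lt_of_le_of_ne (norm_nonneg v) fun h0 => hv ?_
      rw [← h0, mul_zero]
      exact hδ.le
    refine ⟨δ / ‖v‖, by positivity, ?_, rfl⟩
    rw [div_le_iff₀ hv0]
    exact (not_le.1 hv).le

end Clip

/-! ### Descent of the Lyapunov function in dual coordinates. -/

section DualDynamics

variable {m d : ℕ} {D : Set (E d)} {h : E d → ℝ} {ζ : ℝ → ℝ} {f : Fin m → E d → ℝ}
  {W : Matrix (Fin m) (Fin m) ℝ} {η δ L : ℝ}

/-- The gradients of the local objectives in dual coordinates. -/
noncomputable def dualGrad (D : Set (E d)) (h : E d → ℝ) (f : Fin m → E d → ℝ) (i : Fin m)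
    (z : E d) : E d :=
  gradient (f i) (mirrorInv D h z)

/-- The global objective in dual coordinates. -/
noncomputable def dualObj (D : Set (E d)) (h : E d → ℝ) (f : Fin m → E d → ℝ) (z : E d) : ℝ :=
  globalObj f (mirrorInv D h z)

/-- Average the agents' descent inequalities; `avgHess_sub` writes the primal displacement in the
same averaged Hessian that defines the local norm. -/
lemma dualObj_descent (hm : 0 < m) (hLeg : IsLegendreKernel D h)
    (hH : IsHRUC D h ζ) (hf : ∀ i, ContDiffOn ℝ 2 (f i) (interior D)) (hL : 0 < L)
    (hs : ∀ i, IsRelSmooth D h L (f i)) (z w : E d) :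
    dualObj D h f w - dualObj D h f z ≤
      inner ℝ (avg fun i => dualGrad D h f i z) (avgHess D h z w (w - z))
        + L * inner ℝ (w - z) (avgHess D h z w (w - z)) := by
  have hm' : (0 : ℝ) < m := by positivity
  have h1 := Finset.sum_le_sum fun i (_ : i ∈ Finset.univ) =>
    (hs i).descent hL.le hLeg.strictConvex.convexOn hLeg.contDiff (hf i)
      (mirrorInv_mem hLeg hH z) (mirrorInv_mem hLeg hH w)
  simp only [gradient_mirrorInv hLeg hH, Finset.sum_sub_distrib, Finset.sum_add_distrib,
    ← sum_inner, Finset.sum_const, Finset.card_univ, Fintype.card_fin, nsmul_eq_mul] at h1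
  have h2 := mul_le_mul_of_nonneg_left h1 (by positivity : 0 ≤ 1 / (m : ℝ))
  rw [avgHess_sub hLeg hH, dualObj, dualObj, globalObj, globalObj, ← mul_sub, avg, inner_smul_left,
    conj_trivial]
  refine h2.trans_eq ?_
  simp only [dualGrad]
  field_simp

/-- One iteration decreases the Lyapunov function by the size of the clipped step. -/
theorem lyapunov_step (hm : 0 < m) (hLeg : IsLegendreKernel D h) (hH : IsHRUC D h ζ)
    (hf : ∀ i, ContDiffOn ℝ 2 (f i) (interior D)) (hL : 0 < L)
    (hs : ∀ i, IsRelSmooth D h L (f i)) (hW : W ∈ doublyStochastic ℝ (Fin m))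
    (hρ : mixingRate W < 1) (hη : 0 < η) (hδ : 0 < δ)
    (hηle : η ≤ (1 - mixingRate W) ^ 2 / (25 * L * lam m ζ (mixingRate W) δ ^ 2))
    (hζδ : ζ (2 * δ) ≤ (1 - mixingRate W) / 2)
    {z y c z' y' : Fin m → E d} (hc : ∀ i, c i = clip η δ (y i))
    (hz : ∑ i, ‖z i - avg z‖ ^ 2 ≤ m * (mixingRate W / (1 - mixingRate W) * δ) ^ 2)
    (hyg : avg y = avg fun i => dualGrad D h f i (z i))
    (hz' : ∀ i, z' i = mix W (fun j => z j - c j) i)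
    (hy' : ∀ i, y' i = mix W y i + (dualGrad D h f i (z' i) - dualGrad D h f i (z i)))
    {w : E d} (hw : ‖w - avg z'‖ ≤ δ)
    {P P' : E d →L[ℝ] E d} (hP : P = avgHess D h (avg z) (avg z'))
    (hP' : P' = avgHess D h (avg z') w) :
    m * dualObj D h f (avg z')
        + 2 * η / (1 - mixingRate W) * ∑ i, inner ℝ (y' i - avg y') (P' (y' i - avg y'))
        + 3 / 20 * (1 - mixingRate W) / η * ∑ i, inner ℝ (z' i - avg z') (P' (z' i - avg z'))
        + (12 * η)⁻¹ * ∑ i, inner ℝ (c i) (P (c i)) ≤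
      m * dualObj D h f (avg z)
        + 2 * η / (1 - mixingRate W) * ∑ i, inner ℝ (y i - avg y) (P (y i - avg y))
        + 3 / 20 * (1 - mixingRate W) / η * ∑ i, inner ℝ (z i - avg z) (P (z i - avg z)) := by
  have hρ0 : 0 ≤ mixingRate W := mixingRate_nonneg
  set ρ := mixingRate W with hρdef
  have hσ : 0 < 1 - ρ := by linarith
  have hm1 : (1 : ℝ) ≤ m := by exact_mod_cast hm
  have hsm : 1 ≤ √(m : ℝ) := Real.one_le_sqrt.2 hm1
  have hcn : ∀ i, ‖c i‖ ≤ δ := fun i => by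
    rw [hc]
    exact norm_clip_le hη hδ _
  have hzfun : z' = mix W fun j => z j - c j := funext hz'
  have hyfun : y' = fun i => mix W y i + (dualGrad D h f i (z' i) - dualGrad D h f i (z i)) :=
    funext hy'
  have havg : avg z' = avg z - avg c := by rw [hzfun, avg_mix hW, avg_sub]
  have hnac : ‖avg c‖ ≤ δ := norm_avg_le hm hcn
  -- The ball of radius R around the old mean contains all agents and both means: an agent is within
  -- √m ρδ/(1 - ρ) of its mean, and the mean moves by at most δ.
  set R := √(m : ℝ) / (1 - ρ) * δ with hR
  have hr0 : 0 ≤ √(20 * m) / (1 - ρ) * δ := by positivity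
  have hlm : lam m ζ ρ δ = 1 + ζ (√(20 * m) / (1 - ρ) * δ) := rfl
  set lm := lam m ζ ρ δ
  have hlm1 : 1 ≤ lm := by
    rw [hlm]
    linarith [hH.modulus_nonneg hr0]
  -- The diameter fits into the argument of ζ in λ because 2 ≤ √20.
  have hRr : R + R ≤ √(20 * m) / (1 - ρ) * δ := by
    have h1 : 2 * √(m : ℝ) ≤ √(20 * m) := by
      rw [Real.sqrt_mul (by norm_num)]
      refine mul_le_mul_of_nonneg_right ?_ (by positivity)
      exact Real.le_sqrt_of_sq_le (by norm_num)
    calc R + R = 2 * √(m : ℝ) / (1 - ρ) * δ := by rw [hR]; ring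
      _ ≤ _ := by gcongr
  have hball : ∀ ξ ∈ Metric.closedBall (avg z) R, ∀ ξ' ∈ Metric.closedBall (avg z) R, ∀ v,
      inner ℝ v (hess (conj D h) ξ v) ≤ lm * inner ℝ v (hess (conj D h) ξ' v) := by
    intro ξ hξ ξ' hξ' v
    refine inner_hess_conj_le hLeg hH ?_ v
    rw [← dist_eq_norm]
    exact (dist_triangle_right ξ ξ' (avg z)).trans ((add_le_add hξ hξ').trans hRr)
  have hR' : R = √(m : ℝ) * (ρ / (1 - ρ) * δ) + √(m : ℝ) * δ := by
    rw [hR]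
    field_simp
    ring
  have hδR : √(m : ℝ) * (ρ / (1 - ρ) * δ) + δ ≤ R := by
    rw [hR']
    have : 1 * δ ≤ √(m : ℝ) * δ := by gcongr
    linarith
  have hconsensus : ∀ {u : Fin m → E d},
      ∑ i, ‖u i - avg u‖ ^ 2 ≤ m * (ρ / (1 - ρ) * δ) ^ 2 →
      ∀ i, ‖u i - avg u‖ ≤ √(m : ℝ) * (ρ / (1 - ρ) * δ) := by
    intro u hu i
    refine (abs_le_of_sq_le_sq' ?_ (by positivity)).2
    rw [mul_pow, Real.sq_sqrt (by positivity)]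
    exact (Finset.single_le_sum (f := fun i => ‖u i - avg u‖ ^ 2) (fun _ _ => by positivity)
      (Finset.mem_univ i)).trans hu
  have hzmem : ∀ i, z i ∈ Metric.closedBall (avg z) R := fun i => by
    rw [mem_closedBall_iff_norm]
    linarith [hconsensus hz i]
  have hz'c : ∑ i, ‖z' i - avg z'‖ ^ 2 ≤ m * (ρ / (1 - ρ) * δ) ^ 2 := by
    rw [hzfun]
    exact sum_norm_consensus_le hm hW hρ hcn hz
  have havgd : ‖avg z' - avg z‖ ≤ δ := by
    rw [havg, sub_sub_cancel_left, norm_neg]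
    exact hnac
  have hz'mem : ∀ i, z' i ∈ Metric.closedBall (avg z) R := fun i => by
    rw [mem_closedBall_iff_norm]
    have h1 : z' i - avg z = (z' i - avg z') + (avg z' - avg z) := by abel
    rw [h1]
    exact (norm_add_le _ _).trans (by linarith [hconsensus hz'c i])
  have hδR' : δ ≤ R := by
    have : 0 ≤ √(m : ℝ) * (ρ / (1 - ρ) * δ) := by positivity
    linarith
  have hzb : avg z ∈ Metric.closedBall (avg z) R :=
    Metric.mem_closedBall_self (hδ.le.trans hδR')
  have hzb' : avg z' ∈ Metric.closedBall (avg z) R := by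
    rw [mem_closedBall_iff_norm]
    exact havgd.trans hδR'
  have hconv : Convex ℝ (Metric.closedBall (avg z) R) := convex_closedBall _ _
  have hseg : segment ℝ (avg z) (avg z') ⊆ Metric.closedBall (avg z) R :=
    hconv.segment_subset hzb hzb'
  have hPA : ∀ ξ ∈ Metric.closedBall (avg z) R, ∀ v,
      inner ℝ v (P v) ≤ lm * inner ℝ v (hess (conj D h) ξ v) := by
    intro ξ hξ v
    rw [hP]
    exact inner_avgHess_le hLeg hH fun ξ' hξ' => hball ξ' (hseg hξ') ξ hξ v
  have hAP : ∀ ξ ∈ Metric.closedBall (avg z) R, ∀ v,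
      inner ℝ v (hess (conj D h) ξ v) ≤ lm * inner ℝ v (P v) := by
    intro ξ hξ v
    have hlm0 : 0 < lm := by linarith
    rw [hP, ← div_le_iff₀' hlm0]
    refine le_inner_avgHess hLeg hH fun ξ' hξ' => ?_
    rw [div_le_iff₀' hlm0]
    exact hball ξ hξ ξ' (hseg hξ') v
  -- Writing the P norm as ‖B v‖ reduces consensus in local norms to the Euclidean estimates, as B
  -- commutes with mixing and averaging.
  obtain ⟨B, hB⟩ := exists_inner_factor (P := P)
    (by rw [hP]; exact avgHess_symm hLeg hH _ _) (by rw [hP]; exact avgHess_nonneg hLeg hH _ _)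
  obtain ⟨B', hB'⟩ := exists_inner_factor (P := P')
    (by rw [hP']; exact avgHess_symm hLeg hH _ _) (by rw [hP']; exact avgHess_nonneg hLeg hH _ _)
  -- The two consecutive segments share `avg z'` and each has length at most δ, so their points are
  -- within 2δ.
  have hBB' : ∀ v, ‖B' v‖ ^ 2 ≤ (1 + ζ (2 * δ)) * ‖B v‖ ^ 2 := by
    intro v
    rw [← real_inner_self_eq_norm_sq, ← real_inner_self_eq_norm_sq, ← hB, ← hB', hP, hP']
    refine inner_avgHess_le_avgHess hLeg hH (by positivity) (fun ξ hξ ξ' hξ' => ?_) v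
    have hδ' : avg z' ∈ Metric.closedBall (avg z') δ := Metric.mem_closedBall_self hδ.le
    have h1 : ξ ∈ Metric.closedBall (avg z') δ :=
      (convex_closedBall (avg z') δ).segment_subset
        (by rwa [mem_closedBall_iff_norm, norm_sub_rev]) hδ' hξ
    have h2 : ξ' ∈ Metric.closedBall (avg z') δ :=
      (convex_closedBall (avg z') δ).segment_subset hδ' (by rwa [mem_closedBall_iff_norm]) hξ'
    rw [← dist_eq_norm, two_mul]
    exact (dist_triangle_right ξ' ξ (avg z')).trans (add_le_add h2 h1)
  have hκ0 : 0 ≤ 1 + ζ (2 * δ) := by linarith [hH.modulus_nonneg (by positivity : 0 ≤ 2 * δ)]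
  have hLip : ∀ i, ∀ u ∈ Metric.closedBall (avg z) R, ∀ v ∈ Metric.closedBall (avg z) R,
      ‖B (dualGrad D h f i v - dualGrad D h f i u)‖ ^ 2 ≤ (lm * L) ^ 2 * ‖B (v - u)‖ ^ 2 := by
    intro i u hu v hv
    rw [← mul_pow]
    refine pow_le_pow_left₀ (norm_nonneg _) ?_ 2
    exact norm_gradient_mirrorInv_sub_le hLeg hH hL (by linarith) (hs i) (hf i) hB
      (fun ξ hξ => hPA ξ (hconv.segment_subset hu hv hξ))
      (fun ξ hξ => hAP ξ (hconv.segment_subset hu hv hξ))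
  have hstep : 25 * L * lm ^ 2 * η ≤ (1 - ρ) ^ 2 := by
    rwa [le_div_iff₀ (by positivity), mul_comm] at hηle
  choose θ hθ0 hθ hθc using fun i => exists_clip_eq_smul hη hδ (y i)
  have hwpos : 0 < (1 - ρ) ^ 2 / (25 * η) := by positivity
  have hlow := inner_avg_lower hm (B := B) hη hwpos (g₀ := fun i => dualGrad D h f i (avg z))
    hθ0 hθ (fun i => (hc i).trans (hθc i)) hyg
  have hdesc := dualObj_descent hm hLeg hH hf hL hs (avg z) (avg z')
  rw [← hP] at hdesc
  have hdiff : avg z' - avg z = -avg c := by rw [havg]; abel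
  rw [hdiff, map_neg, inner_neg_right, inner_neg_neg, hB, hB, real_inner_self_eq_norm_sq] at hdesc
  have hac : m * ‖B (avg c)‖ ^ 2 ≤ ∑ i, ‖B (c i)‖ ^ 2 := by
    rw [map_avg]
    exact norm_avg_sq_le hm _
  have hsq : ∀ v, inner ℝ v (P v) = ‖B v‖ ^ 2 := fun v => by
    rw [hB, real_inner_self_eq_norm_sq]
  have hsq' : ∀ v, inner ℝ v (P' v) = ‖B' v‖ ^ 2 := fun v => by
    rw [hB', real_inner_self_eq_norm_sq]
  simp only [hsq, hsq']
  refine lyapunov_arith (S₁ := ∑ i, ‖B (z i - avg z)‖ ^ 2) (S := ∑ i, ‖B (c i)‖ ^ 2)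
    (Δ := ∑ i, ‖B (dualGrad D h f i (z' i) - dualGrad D h f i (z i))‖ ^ 2)
    (Γ := ∑ i, ‖B (dualGrad D h f i (avg z) - dualGrad D h f i (z i))‖ ^ 2)
    hη hσ (by linarith) hL hlm1 hstep (Finset.sum_nonneg fun i _ => by positivity)
    (Finset.sum_nonneg fun i _ => by positivity) ?_ ?_ ?_ ?_ ?_
  · rw [hzfun]
    exact consensus_step hm hW hρ hκ0 (by linarith) hBB' z c
  · rw [hyfun]
    exact tracker_step hm hW hρ hκ0 (by linarith) hBB' y _
  · refine (Finset.sum_le_sum fun i _ => hLip i _ (hzmem i) _ (hz'mem i)).trans ?_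
    rw [← Finset.mul_sum]
    refine mul_le_mul_of_nonneg_left ?_ (by positivity)
    rw [hzfun]
    exact increment_le hW B z c
  · refine (Finset.sum_le_sum fun i _ => hLip i _ (hzmem i) _ hzb).trans_eq ?_
    rw [← Finset.mul_sum]
    simp_rw [← norm_neg (B (avg z - _)), ← map_neg, neg_sub]
  · have h1 := mul_le_mul_of_nonneg_left hdesc (by positivity : (0 : ℝ) ≤ m)
    have h2 := mul_le_mul_of_nonneg_left hac hL.le
    linarith

end DualDynamics

/-! ### Counting large terms of a summable sequence. -/

section Counting

/-- A set of indices on which a nonnegative sequence with bounded partial sums is at least `a`. -/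
lemma finite_and_ncard_le {T : Set ℕ} {S : ℕ → ℝ} {K a : ℝ} (ha : 0 < a) (hS : ∀ t, 0 ≤ S t)
    (hK : ∀ n, ∑ t ∈ Finset.range n, S t ≤ K) (hT : ∀ t ∈ T, a ≤ S t) :
    T.Finite ∧ (T.ncard : ℝ) ≤ K / a := by
  have hcard : ∀ F : Finset ℕ, ↑F ⊆ T → (F.card : ℝ) ≤ K / a := by
    intro F hF
    obtain ⟨n, hn⟩ := F.exists_nat_subset_range
    rw [le_div_iff₀ ha]
    calc (F.card : ℝ) * a = ∑ _t ∈ F, a := by simp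
      _ ≤ ∑ t ∈ F, S t := Finset.sum_le_sum fun t ht => hT t (hF ht)
      _ ≤ ∑ t ∈ Finset.range n, S t :=
        Finset.sum_le_sum_of_subset_of_nonneg hn fun t _ _ => hS t
      _ ≤ K := hK n
  have hfin : T.Finite := by
    by_contra hinf
    obtain ⟨n, hn⟩ := exists_nat_gt (K / a)
    obtain ⟨F, hF, hFn⟩ := Set.Infinite.exists_subset_card_eq hinf n
    have := hcard F hF
    rw [hFn] at this
    linarith
  refine ⟨hfin, ?_⟩
  rw [Set.ncard_eq_toFinset_card T hfin]
  exact hcard _ (by simp)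

end Counting

/-! ### Uniform Hessian bounds by compactness. -/

section Bounds

variable {d : ℕ} {D : Set (E d)} {h : E d → ℝ} {ζ : ℝ → ℝ}

/-- The Hessian of the conjugate is bounded above and below along a bounded sequence. -/
lemma exists_hess_bounds (hLeg : IsLegendreKernel D h) (hH : IsHRUC D h ζ) {zb : ℕ → E d}
    (hzb : Bornology.IsBounded (range zb)) :
    ∃ μ M : ℝ, 0 < μ ∧ μ < M ∧ HessLower D h zb μ ∧ HessUpper D h zb M := by
  obtain ⟨R, hR⟩ := hzb.subset_closedBall 0
  have hseg : ∀ t, segment ℝ (zb t) (zb (t + 1)) ⊆ Metric.closedBall 0 R := fun t =>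
    (convex_closedBall _ _).segment_subset (hR ⟨t, rfl⟩) (hR ⟨t + 1, rfl⟩)
  have hK : IsCompact (Metric.closedBall (0 : E d) R) := isCompact_closedBall 0 R
  have hA := continuous_hess_conj hLeg hH
  obtain ⟨M, hM⟩ := hK.exists_bound_of_continuousOn hA.continuousOn
  have hcont : Continuous fun p : E d × E d => inner ℝ p.2 (hess (conj D h) p.1 p.2) :=
    continuous_snd.inner ((hA.comp continuous_fst).clm_apply continuous_snd)
  -- A positive lower bound on ball times unit sphere; it also exists when d = 0 and the sphere is
  -- empty.
  obtain ⟨μ, hμ0, hμ⟩ := (hK.prod (isCompact_sphere (0 : E d) 1)).exists_forall_le'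
    hcont.continuousOn (a := 0) (by
      rintro ⟨z, v⟩ ⟨-, hv⟩
      refine inner_hess_conj_pos hLeg hH z ?_
      rintro rfl
      simp at hv)
  -- The enlargement only serves to make the upper bound strictly exceed μ.
  refine ⟨μ, max M μ + 1, hμ0, by linarith [le_max_right M μ], ?_, ?_⟩
  · intro t z hz v
    rcases eq_or_ne v 0 with rfl | hv
    · simp
    have hv0 : ‖v‖ ≠ 0 := norm_ne_zero_iff.2 hv
    have h1 := hμ (z, ‖v‖⁻¹ • v) ⟨hseg t hz, by simp [norm_smul, hv0]⟩
    simp only [map_smul, inner_smul_left, inner_smul_right, conj_trivial] at h1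
    calc μ * ‖v‖ ^ 2
        ≤ (‖v‖⁻¹ * (‖v‖⁻¹ * inner ℝ v (hess (conj D h) z v))) * ‖v‖ ^ 2 := by gcongr
      _ = _ := by field_simp
  · intro t z hz v
    calc inner ℝ v (hess (conj D h) z v) ≤ ‖v‖ * ‖hess (conj D h) z v‖ := real_inner_le_norm _ _
      _ ≤ ‖v‖ * (M * ‖v‖) := by
        gcongr
        exact (hess (conj D h) z).le_of_opNorm_le (hM z (hseg t hz)) v
      _ = M * ‖v‖ ^ 2 := by ring
      _ ≤ _ := by
        gcongr
        linarith [le_max_left M μ]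

end Bounds

/-! ### Invariants of the iterates and summation of the descent. -/

section Iterates

variable {m d : ℕ} {D : Set (E d)} {h : E d → ℝ} {ζ : ℝ → ℝ} {f : Fin m → E d → ℝ}
  {W : Matrix (Fin m) (Fin m) ℝ} {η δ L : ℝ} {x0 : E d} {y0 : Fin m → E d}

lemma iter_z_succ (t : ℕ) (i : Fin m) : (iter D h f W η δ x0 y0 (t + 1)).z i =
    mix W (fun j => (iter D h f W η δ x0 y0 t).z j - clip η δ ((iter D h f W η δ x0 y0 t).y j)) i :=
  rfl

lemma iter_x (hLeg : IsLegendreKernel D h) (hH : IsHRUC D h ζ) (hx0 : x0 ∈ interior D) (t : ℕ)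
    (i : Fin m) :
    (iter D h f W η δ x0 y0 t).x i = mirrorInv D h ((iter D h f W η δ x0 y0 t).z i) := by
  cases t with
  | zero => exact (mirrorInv_gradient hLeg hx0).symm
  | succ t =>
    rw [← gradient_conj hLeg hH]
    rfl

lemma iter_y_succ (hLeg : IsLegendreKernel D h) (hH : IsHRUC D h ζ) (hx0 : x0 ∈ interior D)
    (t : ℕ) (i : Fin m) :
    (iter D h f W η δ x0 y0 (t + 1)).y i = mix W (iter D h f W η δ x0 y0 t).y i +
      (dualGrad D h f i ((iter D h f W η δ x0 y0 (t + 1)).z i)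
        - dualGrad D h f i ((iter D h f W η δ x0 y0 t).z i)) := by
  rw [dualGrad, dualGrad, ← iter_x hLeg hH hx0, ← iter_x hLeg hH hx0, ← add_sub_assoc]
  rfl

/-- Gradient tracking: mixing preserves averages and the gradient differences telescope. -/
lemma avg_iter_y (hLeg : IsLegendreKernel D h) (hH : IsHRUC D h ζ)
    (hf : ∀ i, ContDiffOn ℝ 2 (f i) (interior D)) (hW : W ∈ doublyStochastic ℝ (Fin m))
    (hx0 : x0 ∈ interior D) (hy0 : avg y0 = gradient (globalObj f) x0) (t : ℕ) :
    avg (iter D h f W η δ x0 y0 t).y =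
      avg fun i => dualGrad D h f i ((iter D h f W η δ x0 y0 t).z i) := by
  induction t with
  | zero =>
    refine hy0.trans ?_
    rw [gradient_globalObj fun i => differentiableAt_of_contDiffOn isOpen_interior (hf i) hx0]
    simp [dualGrad, iter, mirrorInv_gradient hLeg hx0]
  | succ t ih =>
    rw [funext (iter_y_succ hLeg hH hx0 t), avg_add, avg_sub, avg_mix hW, ih]
    abel

/-- Clipping bounds every step by δ whatever the trackers are, so this needs no descent; the error
starts at zero. -/
lemma iter_consensus (hm : 0 < m) (hW : W ∈ doublyStochastic ℝ (Fin m))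
    (hρ : mixingRate W < 1) (hη : 0 < η) (hδ : 0 < δ) (t : ℕ) :
    ∑ i, ‖(iter D h f W η δ x0 y0 t).z i - avg (iter D h f W η δ x0 y0 t).z‖ ^ 2 ≤
      m * (mixingRate W / (1 - mixingRate W) * δ) ^ 2 := by
  induction t with
  | zero =>
    have h1 : avg (fun _ : Fin m => gradient h x0) = gradient h x0 := avg_const hm _
    simp only [iter, h1, sub_self]
    simp
    positivity
  | succ t ih =>
    rw [funext (iter_z_succ t)]
    exact sum_norm_consensus_le hm hW hρ (fun i => norm_clip_le hη hδ _) ih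

lemma zbar_succ (hW : W ∈ doublyStochastic ℝ (Fin m)) (t : ℕ) :
    zbar D h f W η δ x0 y0 (t + 1) = zbar D h f W η δ x0 y0 t
      - avg fun i => clip η δ ((iter D h f W η δ x0 y0 t).y i) := by
  rw [zbar, funext (iter_z_succ t), avg_mix hW, avg_sub]
  rfl

lemma norm_zbar_succ_sub_le (hm : 0 < m) (hW : W ∈ doublyStochastic ℝ (Fin m)) (hη : 0 < η)
    (hδ : 0 < δ) (t : ℕ) :
    ‖zbar D h f W η δ x0 y0 (t + 1) - zbar D h f W η δ x0 y0 t‖ ≤ δ := by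
  rw [zbar_succ hW, sub_sub_cancel_left, norm_neg]
  exact norm_avg_le hm fun i => norm_clip_le hη hδ _

/-- The Hessian of the conjugate averaged over the step of the mean dual variable. -/
noncomputable def stepHess (D : Set (E d)) (h : E d → ℝ) (f : Fin m → E d → ℝ)
    (W : Matrix (Fin m) (Fin m) ℝ) (η δ : ℝ) (x0 : E d) (y0 : Fin m → E d) (t : ℕ) :
    E d →L[ℝ] E d :=
  avgHess D h (zbar D h f W η δ x0 y0 t) (zbar D h f W η δ x0 y0 (t + 1))

/-- The squared size of the clipped directions, in the local norm. -/
noncomputable def stepSize (D : Set (E d)) (h : E d → ℝ) (f : Fin m → E d → ℝ)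
    (W : Matrix (Fin m) (Fin m) ℝ) (η δ : ℝ) (x0 : E d) (y0 : Fin m → E d) (t : ℕ) : ℝ :=
  ∑ i, inner ℝ (clip η δ ((iter D h f W η δ x0 y0 t).y i))
    (stepHess D h f W η δ x0 y0 t (clip η δ ((iter D h f W η δ x0 y0 t).y i)))

/-- The Lyapunov function: the objective at the mean and the two consensus errors. -/
noncomputable def lyapunov (D : Set (E d)) (h : E d → ℝ) (f : Fin m → E d → ℝ)
    (W : Matrix (Fin m) (Fin m) ℝ) (η δ : ℝ) (x0 : E d) (y0 : Fin m → E d) (t : ℕ) : ℝ :=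
  let s := iter D h f W η δ x0 y0 t
  let P := stepHess D h f W η δ x0 y0 t
  m * dualObj D h f (avg s.z)
    + 2 * η / (1 - mixingRate W) * ∑ i, inner ℝ (s.y i - avg s.y) (P (s.y i - avg s.y))
    + 3 / 20 * (1 - mixingRate W) / η * ∑ i, inner ℝ (s.z i - avg s.z) (P (s.z i - avg s.z))

lemma stepSize_nonneg (hLeg : IsLegendreKernel D h) (hH : IsHRUC D h ζ) (t : ℕ) :
    0 ≤ stepSize D h f W η δ x0 y0 t :=
  Finset.sum_nonneg fun _ _ => avgHess_nonneg hLeg hH _ _ _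

/-- An agent whose clipping is active moves by a vector of norm exactly δ. -/
lemma le_stepSize (hLeg : IsLegendreKernel D h) (hH : IsHRUC D h ζ) (hδ : 0 < δ) {μ : ℝ}
    (hμ : HessLower D h (zbar D h f W η δ x0 y0) μ) {t : ℕ}
    (ht : t ∈ clippedSteps D h f W η δ x0 y0) : μ * δ ^ 2 ≤ stepSize D h f W η δ x0 y0 t := by
  obtain ⟨i, hi⟩ := ht
  have h1 := Finset.single_le_sum (f := fun i =>
    inner ℝ (clip η δ ((iter D h f W η δ x0 y0 t).y i))
    (stepHess D h f W η δ x0 y0 t (clip η δ ((iter D h f W η δ x0 y0 t).y i))))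
    (fun _ _ => avgHess_nonneg hLeg hH _ _ _) (Finset.mem_univ i)
  refine le_trans ?_ h1
  refine le_inner_avgHess hLeg hH fun ξ hξ => ?_
  have h2 := hμ t ξ hξ (clip η δ ((iter D h f W η δ x0 y0 t).y i))
  rwa [norm_clip_of_ne hδ hi] at h2

lemma mul_dualObj_le_lyapunov (hLeg : IsLegendreKernel D h) (hH : IsHRUC D h ζ) (hη : 0 < η)
    (hρ : mixingRate W < 1) (t : ℕ) :
    m * dualObj D h f (zbar D h f W η δ x0 y0 t) ≤ lyapunov D h f W η δ x0 y0 t := by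
  have hσ : 0 < 1 - mixingRate W := by linarith
  have h1 : ∀ v : Fin m → E d, 0 ≤ ∑ i, inner ℝ (v i - avg v)
      (stepHess D h f W η δ x0 y0 t (v i - avg v)) := fun v =>
    Finset.sum_nonneg fun _ _ => avgHess_nonneg hLeg hH _ _ _
  have h2 := mul_nonneg (by positivity : 0 ≤ 2 * η / (1 - mixingRate W))
    (h1 (iter D h f W η δ x0 y0 t).y)
  have h3 := mul_nonneg (by positivity : 0 ≤ 3 / 20 * (1 - mixingRate W) / η)
    (h1 (iter D h f W η δ x0 y0 t).z)
  simp only [lyapunov, zbar]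
  linarith

/-- The free point `w` of `lyapunov_step` is the mean at time t + 2, the far end of the segment that
defines the next local norm. -/
theorem lyapunov_succ_le (hm : 0 < m) (hLeg : IsLegendreKernel D h) (hH : IsHRUC D h ζ)
    (hf : ∀ i, ContDiffOn ℝ 2 (f i) (interior D)) (hL : 0 < L)
    (hs : ∀ i, IsRelSmooth D h L (f i)) (hW : W ∈ doublyStochastic ℝ (Fin m))
    (hρ : mixingRate W < 1) (hη : 0 < η) (hδ : 0 < δ)
    (hηle : η ≤ (1 - mixingRate W) ^ 2 / (25 * L * lam m ζ (mixingRate W) δ ^ 2))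
    (hζδ : ζ (2 * δ) ≤ (1 - mixingRate W) / 2) (hx0 : x0 ∈ interior D)
    (hy0 : avg y0 = gradient (globalObj f) x0) (t : ℕ) :
    lyapunov D h f W η δ x0 y0 (t + 1) + (12 * η)⁻¹ * stepSize D h f W η δ x0 y0 t ≤
      lyapunov D h f W η δ x0 y0 t :=
  lyapunov_step hm hLeg hH hf hL hs hW hρ hη hδ hηle hζδ (fun _ => rfl)
    (iter_consensus hm hW hρ hη hδ t) (avg_iter_y hLeg hH hf hW hx0 hy0 t) (iter_z_succ t)
    (iter_y_succ hLeg hH hx0 t) (norm_zbar_succ_sub_le hm hW hη hδ (t + 1)) rfl rfl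

lemma lyapunov_add_sum_le
    (hstep : ∀ t, lyapunov D h f W η δ x0 y0 (t + 1)
      + (12 * η)⁻¹ * stepSize D h f W η δ x0 y0 t ≤ lyapunov D h f W η δ x0 y0 t) (n : ℕ) :
    lyapunov D h f W η δ x0 y0 n
      + (12 * η)⁻¹ * ∑ t ∈ Finset.range n, stepSize D h f W η δ x0 y0 t ≤
      lyapunov D h f W η δ x0 y0 0 := by
  induction n with
  | zero => simp
  | succ n ih =>
    rw [Finset.sum_range_succ, mul_add]
    linarith [hstep n]

/-- With zero trackers the method does not move. -/
lemma iter_eq_of_trackers_zero (hLeg : IsLegendreKernel D h) (hH : IsHRUC D h ζ)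
    (hδ : 0 < δ) (hW : W ∈ doublyStochastic ℝ (Fin m)) (hx0 : x0 ∈ interior D)
    (hy0 : ∀ i, y0 i = 0) (t : ℕ) :
    (iter D h f W η δ x0 y0 t).y = (fun _ => 0) ∧
      (iter D h f W η δ x0 y0 t).z = fun _ => gradient h x0 := by
  have hclip : clip η δ (0 : E d) = 0 := by simp [clip, hδ.le]
  induction t with
  | zero => exact ⟨funext hy0, rfl⟩
  | succ t ih =>
    have hz : (iter D h f W η δ x0 y0 (t + 1)).z = fun _ => gradient h x0 := by
      funext i
      rw [iter_z_succ, ih.1, ih.2]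
      simp only [hclip, sub_zero]
      exact mix_const hW _ i
    refine ⟨funext fun i => ?_, hz⟩
    rw [iter_y_succ hLeg hH hx0, hz, ih.1, ih.2, mix_const hW]
    simp

end Iterates

end DMGT

theorem mainTheorem3 {m d : ℕ} (hm : 0 < m)
    (D : Set (DMGT.E d)) (h : DMGT.E d → ℝ) (ζ : ℝ → ℝ)
    (hLeg : DMGT.IsLegendreKernel D h) (hHRUC : DMGT.IsHRUC D h ζ)
    (f : Fin m → DMGT.E d → ℝ)
    (hf : ∀ i, ContDiffOn ℝ 2 (f i) (interior D))
    (flow : ℝ) (hflow : ∀ x ∈ interior D, flow ≤ DMGT.globalObj f x)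
    (L : ℝ) (hL : 0 < L) (hsmooth : ∀ i, DMGT.IsRelSmooth D h L (f i))
    (W : Matrix (Fin m) (Fin m) ℝ) (hWsymm : W.IsSymm)
    (hWds : W ∈ doublyStochastic ℝ (Fin m)) (hρ : DMGT.mixingRate W < 1)
    (hlevel : ∀ c : ℝ, Bornology.IsBounded
      (gradient h '' {x | x ∈ interior D ∧ DMGT.globalObj f x ≤ c}))
    (η δ : ℝ) (hη : 0 < η) (hδ : 0 < δ)
    (hηle : η ≤ (1 - DMGT.mixingRate W) ^ 2 /
      (25 * L * DMGT.lam m ζ (DMGT.mixingRate W) δ ^ 2))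
    (hζδ : ζ (2 * δ) ≤ (1 - DMGT.mixingRate W) / 2)
    (x0 : DMGT.E d) (hx0 : x0 ∈ interior D) (y0 : Fin m → DMGT.E d)
    (hy0 : (∀ i, y0 i = 0) ∨ DMGT.avg y0 = gradient (DMGT.globalObj f) x0) :
    (DMGT.clippedSteps D h f W η δ x0 y0).Finite ∧
    (∃ μ M : ℝ, 0 < μ ∧ μ < M ∧
      DMGT.HessLower D h (DMGT.zbar D h f W η δ x0 y0) μ ∧
      DMGT.HessUpper D h (DMGT.zbar D h f W η δ x0 y0) M) ∧
    ((∀ i j, y0 i = y0 j) → ∀ μ : ℝ, 0 < μ →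
      DMGT.HessLower D h (DMGT.zbar D h f W η δ x0 y0) μ →
      ((DMGT.clippedSteps D h f W η δ x0 y0).ncard : ℝ) ≤
        12 * m * η * (DMGT.globalObj f x0 - flow) / (μ * δ ^ 2)) := by
  open DMGT in
  have hm' : (0 : ℝ) < m := by positivity
  -- Zero trackers need not average to the gradient, so the tracking invariant may fail; but then
  -- the method is stationary.
  rcases hy0 with hy0 | hy0
  · have hit := iter_eq_of_trackers_zero (f := f) (η := η) hLeg hHRUC hδ hWds hx0 hy0
    have hempty : clippedSteps D h f W η δ x0 y0 = ∅ := by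
      refine Set.eq_empty_iff_forall_notMem.2 ?_
      rintro t ⟨i, hi⟩
      rw [(hit t).1] at hi
      simp [clip, hδ.le] at hi
    have hzb : ∀ t, zbar D h f W η δ x0 y0 t = gradient h x0 := fun t => by
      rw [zbar, (hit t).2, avg_const hm]
    refine ⟨by simp [hempty], exists_hess_bounds hLeg hHRUC ?_, fun _ μ hμ _ => ?_⟩
    · refine (Bornology.isBounded_singleton (x := gradient h x0)).subset ?_
      rintro _ ⟨t, rfl⟩
      exact hzb t
    · have := sub_nonneg.2 (hflow x0 hx0)
      rw [hempty, Set.ncard_empty, Nat.cast_zero]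
      positivity
  · have hstep := lyapunov_succ_le hm hLeg hHRUC hf hL hsmooth hWds hρ hη hδ hηle hζδ hx0 hy0
    have hsum := lyapunov_add_sum_le hstep
    have hobj := fun t => mul_dualObj_le_lyapunov (f := f) (δ := δ) (x0 := x0) (y0 := y0)
      hLeg hHRUC hη hρ t
    have hbdd : Bornology.IsBounded (Set.range (zbar D h f W η δ x0 y0)) := by
      -- Descent gives f ≤ V₀/m at the primal image of each mean, with V₀ the initial Lyapunov
      -- value, and `∇h` sends that image back to the mean.
      refine (hlevel (lyapunov D h f W η δ x0 y0 0 / m)).subset ?_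
      rintro _ ⟨t, rfl⟩
      refine ⟨mirrorInv D h (zbar D h f W η δ x0 y0 t), ⟨mirrorInv_mem hLeg hHRUC _, ?_⟩,
        gradient_mirrorInv hLeg hHRUC _⟩
      have h1 : 0 ≤ (12 * η)⁻¹ * ∑ s ∈ Finset.range t, stepSize D h f W η δ x0 y0 s :=
        mul_nonneg (by positivity) (Finset.sum_nonneg fun s _ => stepSize_nonneg hLeg hHRUC s)
      rw [le_div_iff₀ hm', mul_comm]
      have h2 := hobj t
      rw [dualObj] at h2
      linarith [hsum t]
    have hK : ∀ n, ∑ t ∈ Finset.range n, stepSize D h f W η δ x0 y0 t ≤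
        12 * η * (lyapunov D h f W η δ x0 y0 0 - m * flow) := by
      intro n
      rw [← inv_mul_le_iff₀ (by positivity)]
      have h1 := mul_le_mul_of_nonneg_left
        (hflow _ (mirrorInv_mem hLeg hHRUC (zbar D h f W η δ x0 y0 n))) hm'.le
      have h2 := hobj n
      rw [dualObj] at h2
      linarith [hsum n]
    have hbounds := exists_hess_bounds hLeg hHRUC hbdd
    refine ⟨?_, hbounds, fun hyc μ hμ hlow => ?_⟩
    · obtain ⟨μ, -, hμ, -, hlow, -⟩ := hbounds
      exact (finite_and_ncard_le (by positivity : 0 < μ * δ ^ 2) (stepSize_nonneg hLeg hHRUC) hK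
        fun t ht => le_stepSize hLeg hHRUC hδ hlow ht).1
    · have h1 := (finite_and_ncard_le (by positivity : 0 < μ * δ ^ 2)
        (stepSize_nonneg hLeg hHRUC) hK fun t ht => le_stepSize hLeg hHRUC hδ hlow ht).2
      -- With equal trackers and a common start both consensus sums vanish at time 0.
      have h2 : lyapunov D h f W η δ x0 y0 0 = m * globalObj f x0 := by
        have hya : ∀ i, avg y0 = y0 i := fun i => by
          rw [show y0 = fun _ => y0 i from funext fun j => hyc j i, avg_const hm]
        have hza : avg (fun _ : Fin m => gradient h x0) = gradient h x0 := avg_const hm _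
        simp [lyapunov, iter, hza, ← hya, dualObj, mirrorInv_gradient hLeg hx0]
      rw [h2] at h1
      refine h1.trans_eq ?_
      ring
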